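/- Let $p,q,r\in[0,1]$ with $p+q\le 1$ and $p+q+r>0$. Label the vertices of $\mathbb{Z}^2$ and its directed edges $((x,y),(x+1,y))$ and $((x,y),(x,y+1))$ independently at random: each vertex is a trap with probability $p$, a target with probability $q$ and open with probability $1-p-q$; each edge is a trap with probability $r$ and open with probability $1-r$. In the generalized percolation game a token is placed at an initial vertex $v\in\mathbb{Z}^2$, and two players, who know all labels, alternately move it from its current position $(x,y)$ to $(x+1,y)$ or $(x,y+1)$. A player who moves the token along a trap edge or to a trap vertex loses; a player who moves it along an open edge to a target vertex wins; otherwise the game goes on. (The initial vertex is treated as if the second player had just moved the token to it: the first player wins if it is a trap, and loses if it is a target.) The game from $v$ is a draw if neither player has a winning strategy. Suppose that $p,q,r\le 1/50$, that $$2(p+q)+6r^{2}+3r(p+2q)\ \ge\ 4r+(p+q)^{2},$$ and that at least one of the following four conditions holds: 1. $p(1-p)\le q\{1-q-r(1-p-q)\}$; 2. $q\{1-q-r(1-p-q)\}<p(1-p)\le\{q+r(1-p-q)\}\{1-q-r(1-p-q)\}$ and $p-2q+pq+qr-3pr-2p^{2}+3q^{2}\le 0$; 3. $q\{1-q-r(1-p-q)\}<p(1-p)\le\{q+r(1-p-q)\}\{1-q-r(1-p-q)\}$,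 $\;p-2q+pq+qr-3pr-2p^{2}+3q^{2}>0$ and $p+4q+9pr+5qr+6r^{2}\ge 4r+p^{2}+4q^{2}+5pq$; 4. $q+r(1-p-q)<p$ and $6q+10pr+4qr+p^{2}+6r^{2}\ge 4r+6pq+7q^{2}$. Then, for every initial vertex $v$, the game is a draw with probability $0$. In particular, for every $0<\varepsilon\le 1/50$ the triple $p=q=r=\varepsilon$ satisfies the displayed inequality and condition 2, so that the game with these parameters is a draw with probability $0$ from every initial vertex. -/

import Mathlib

open MeasureTheory

namespace PercolationGame

/-! ### The random board -/

/-- Vertices of the square lattice. -/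
abbrev Vertex := ℤ × ℤ

/-- The two directions in which the token may be moved. -/
inductive Dir
  | right
  | up

/-- `step (x, y) d` is `(x + 1, y)` or `(x, y + 1)`. -/
def step (v : Vertex) : Dir → Vertex
  | Dir.right => (v.1 + 1, v.2)
  | Dir.up => (v.1, v.2 + 1)

/-- The pair `(v, d)` stands for the directed edge from `v` to `step v d`. -/
abbrev Edge := Vertex × Dir

/-- Vertex labels; `free` is the label "open". -/
inductive VertexLabel
  | trap
  | target
  | free

/-- Edge labels; `free` is the label "open". -/
inductive EdgeLabel
  | trap
  | free

instance : MeasurableSpace VertexLabel := ⊤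

instance : MeasurableSpace EdgeLabel := ⊤

/-- A configuration: a label on every vertex and a label on every directed edge. -/
abbrev Board := (Vertex → VertexLabel) × (Edge → EdgeLabel)

/-- The parameter space of the triples `(p, q, r)`. -/
def Theta : Set (ℝ × ℝ × ℝ) :=
  {θ | θ.1 ∈ Set.Icc 0 1 ∧ θ.2.1 ∈ Set.Icc 0 1 ∧ θ.2.2 ∈ Set.Icc 0 1 ∧
    0 < θ.1 + θ.2.1 + θ.2.2 ∧ θ.1 + θ.2.1 ≤ 1}

/-- Law of one vertex label: trap with probability `p`, target with probability `q`, open with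
probability `1 - p - q`. -/
noncomputable def vertexLaw (θ : Theta) : Measure VertexLabel :=
  ENNReal.ofReal θ.1.1 • Measure.dirac VertexLabel.trap
    + ENNReal.ofReal θ.1.2.1 • Measure.dirac VertexLabel.target
    + ENNReal.ofReal (1 - θ.1.1 - θ.1.2.1) • Measure.dirac VertexLabel.free

/-- Law of one edge label: trap with probability `r`, open with probability `1 - r`. -/
noncomputable def edgeLaw (θ : Theta) : Measure EdgeLabel :=
  ENNReal.ofReal θ.1.2.2 • Measure.dirac EdgeLabel.trap
    + ENNReal.ofReal (1 - θ.1.2.2) • Measure.dirac EdgeLabel.free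

instance (θ : Theta) : IsProbabilityMeasure (vertexLaw θ) := by
  obtain ⟨⟨p, q, r⟩, hp, hq, hr, -, hpq⟩ := θ
  refine ⟨?_⟩
  simp only [vertexLaw, Measure.coe_add, Measure.coe_smul, Pi.add_apply, Pi.smul_apply,
    measure_univ, smul_eq_mul, mul_one]
  have h1 : 0 ≤ p := hp.1
  have h2 : 0 ≤ q := hq.1
  have h3 : p + q ≤ 1 := hpq
  rw [← ENNReal.ofReal_add h1 h2, ← ENNReal.ofReal_add (by linarith) (by linarith)]
  simp

instance (θ : Theta) : IsProbabilityMeasure (edgeLaw θ) := by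
  obtain ⟨⟨p, q, r⟩, hp, hq, hr, -, hpq⟩ := θ
  refine ⟨?_⟩
  simp only [edgeLaw, Measure.coe_add, Measure.coe_smul, Pi.add_apply, Pi.smul_apply,
    measure_univ, smul_eq_mul, mul_one]
  have h1 : 0 ≤ r := hr.1
  have h2 : r ≤ 1 := hr.2
  rw [← ENNReal.ofReal_add h1 (by linarith)]
  simp

/-- Law of the random board: all vertex labels and all edge labels are independent. -/
noncomputable def boardLaw (θ : Theta) : Measure Board :=
  (Measure.infinitePi fun _ : Vertex => vertexLaw θ).prod
    (Measure.infinitePi fun _ : Edge => edgeLaw θ)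

instance (θ : Theta) : IsProbabilityMeasure (boardLaw θ) := by
  unfold boardLaw
  infer_instance

/-! ### The game on a fixed board -/

/-- The player who makes the first move, and the other one. -/
inductive Player
  | first
  | second

/-- The opponent of a player. -/
def Player.opponent : Player → Player
  | Player.first => Player.second
  | Player.second => Player.first

/-- The player who makes move number `n`, where moves are numbered from `0`. -/
def mover (n : ℕ) : Player :=
  if Even n then Player.first else Player.second

/-- The position of the token after the first `n` moves of the sequence `m`, starting at `v`. -/
def position (v : Vertex) (m : ℕ → Dir) : ℕ → Vertex
  | 0 => v
  | n + 1 => step (position v m n) (m n)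

/-- Moving from `u` in direction `d` loses at once: the edge used or the vertex reached is a trap.
A trap edge loses whatever the label of its endpoint. -/
def LosingMove (ω : Board) (u : Vertex) (d : Dir) : Prop :=
  ω.2 (u, d) = EdgeLabel.trap ∨ ω.1 (step u d) = VertexLabel.trap

/-- Moving from `u` in direction `d` wins at once: an open edge to a target. -/
def WinningMove (ω : Board) (u : Vertex) (d : Dir) : Prop :=
  ω.2 (u, d) = EdgeLabel.free ∧ ω.1 (step u d) = VertexLabel.target

/-- Moving from `u` in direction `d` does not end the game: an open edge to an open vertex. -/
def NeutralMove (ω : Board) (u : Vertex) (d : Dir) : Prop :=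
  ω.2 (u, d) = EdgeLabel.free ∧ ω.1 (step u d) = VertexLabel.free

/-- The play with initial vertex `v` and moves `m 0, m 1, …` ends with a win of `P`; moves after
the end of the game are irrelevant. The initial vertex counts as a vertex to which the second
player has just moved the token: if it is a trap, then the first player wins, and if it is a
target, then the second player wins, before any move is made. -/
def WonBy (ω : Board) (v : Vertex) (m : ℕ → Dir) (P : Player) : Prop :=
  match ω.1 v with
  | VertexLabel.trap => P = Player.first
  | VertexLabel.target => P = Player.second
  | VertexLabel.free =>
    ∃ n : ℕ, (∀ k < n, NeutralMove ω (position v m k) (m k)) ∧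
      ((WinningMove ω (position v m n) (m n) ∧ P = mover n) ∨
        (LosingMove ω (position v m n) (m n) ∧ P = (mover n).opponent))

/-- A strategy chooses the next move in view of the list of all earlier moves. (It may depend on
the board, which both players know.) -/
abbrev Strategy := List Dir → Dir

/-- In the play with moves `m`, the player `P` follows the strategy `σ`. -/
def Follows (P : Player) (σ : Strategy) (m : ℕ → Dir) : Prop :=
  ∀ n : ℕ, mover n = P → m n = σ ((List.range n).map m)

/-- `P` can force a win in the game with initial vertex `v`. -/
def HasWinningStrategy (ω : Board) (v : Vertex) (P : Player) : Prop :=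
  ∃ σ : Strategy, ∀ m : ℕ → Dir, Follows P σ m → WonBy ω v m P

/-- The game with initial vertex `v` results in a draw: neither player can force a win. -/
def Draw (ω : Board) (v : Vertex) : Prop :=
  ∀ P : Player, ¬ HasWinningStrategy ω v P

/-! ### The conditions on the parameters -/

/-- The inequality assumed in all regimes. -/
def UniversalCondition (p q r : ℝ) : Prop :=
  2 * (p + q) + 6 * r ^ 2 + 3 * r * (p + 2 * q) ≥ 4 * r + (p + q) ^ 2

/-- The first regime. -/
def RegimeOne (p q r : ℝ) : Prop :=
  p * (1 - p) ≤ q * (1 - q - r * (1 - p - q))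

/-- The second regime. -/
def RegimeTwo (p q r : ℝ) : Prop :=
  q * (1 - q - r * (1 - p - q)) < p * (1 - p) ∧
  p * (1 - p) ≤ (q + r * (1 - p - q)) * (1 - q - r * (1 - p - q)) ∧
  p - 2 * q + p * q + q * r - 3 * p * r - 2 * p ^ 2 + 3 * q ^ 2 ≤ 0

/-- The third regime. -/
def RegimeThree (p q r : ℝ) : Prop :=
  q * (1 - q - r * (1 - p - q)) < p * (1 - p) ∧
  p * (1 - p) ≤ (q + r * (1 - p - q)) * (1 - q - r * (1 - p - q)) ∧
  p - 2 * q + p * q + q * r - 3 * p * r - 2 * p ^ 2 + 3 * q ^ 2 > 0 ∧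
  p + 4 * q + 9 * p * r + 5 * q * r + 6 * r ^ 2 ≥ 4 * r + p ^ 2 + 4 * q ^ 2 + 5 * p * q

/-- The fourth regime. -/
def RegimeFour (p q r : ℝ) : Prop :=
  q + r * (1 - p - q) < p ∧
  6 * q + 10 * p * r + 4 * q * r + p ^ 2 + 6 * r ^ 2 ≥ 4 * r + 6 * p * q + 7 * q ^ 2

end PercolationGame

open MeasureTheory ProbabilityTheory

namespace PercolationGame

/-! ### Statuses of the vertices -/

/-! A draw forces `status` to be `draw` (`status_eq_draw_of_draw`), so it is enough to show that
this status has probability zero at every vertex. The status of a vertex is a function of the labels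
at that vertex and of the statuses of its two successors (`status_eq_update`). Hence the statuses on
the antidiagonal `x + y = k` arise from those on `x + y = k + 1` and from independent fresh labels:
a probabilistic cellular automaton with local rule `transition`. By translation invariance of the
board, a block of consecutive vertices has the same joint law of statuses on every antidiagonal.

Therefore a local potential, here the mean of `weight` over three neighbouring statuses, has the
same expectation before and after one step of the automaton. On the other hand, for each word of
four statuses, `driftGap ≥ 0` says that the step lowers the potential by at least `(q + p ^ 2) / 50`
times the number of draws in the middle of the word, up to a difference of `corrector` terms whose
expectations cancel. Taking expectations, a positive multiple of the density of draws is at most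
zero (`boardLaw_quadruple_eq_zero`).

The parameters enter only through `p, q, r ≤ 1/50` and `r ≤ 7/4 * q + p ^ 2`. Edge traps help draws
survive next to losing vertices, and this inequality keeps that effect below the gain. Each of the
four regimes implies it (`le_of_regime`): to first order they give `r ≤ q`, `r ≤ 3/2 q`, `r ≤ 5/3 q`
and `r ≤ 3/2 q`. The term `p ^ 2` is needed because the fourth regime admits `q = 0` with `r` of
order `p ^ 2`. -/

/-- The outcome of the game for the player about to move from a vertex. -/
inductive Status
  | win
  | lose
  | draw

instance : DecidableEq Status := fun a b => by
  cases a <;> cases b <;> first | exact isTrue rfl | exact isFalse nofun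

instance : Fintype Status := ⟨{.win, .lose, .draw}, fun a => by cases a <;> decide⟩

open Status

/-- What an edge makes of the status of its endpoint: a trap edge is as bad for the player using
it as an open edge to a vertex from which the opponent wins. -/
def throughEdge : EdgeLabel → Status → Status
  | .trap, _ => win
  | .free, s => s

/-- The status of an open vertex in terms of the statuses of its two successors. -/
def combine : Status → Status → Status
  | lose, _ => win
  | _, lose => win
  | win, win => lose
  | _, _ => draw

/-- The status of a vertex in terms of its label, the labels of its upward and its rightward edge,
and the statuses of the endpoints of these edges. -/
def update : VertexLabel → EdgeLabel → EdgeLabel → Status → Status → Status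
  | .trap, _, _, _, _ => win
  | .target, _, _, _, _ => lose
  | .free, e, e', s, s' => combine (throughEdge e s) (throughEdge e' s')

/-- With `draw` read as "not yet decided", `update` is monotone in the information about the
successors. This is why a decided horizon status never changes when the horizon grows. -/
theorem update_mono {l : VertexLabel} {e e' : EdgeLabel} {s s' t t' : Status}
    (h : s ≠ draw → t = s) (h' : s' ≠ draw → t' = s') (hu : update l e e' s s' ≠ draw) :
    update l e e' t t' = update l e e' s s' := by
  cases l <;> cases e <;> cases e' <;> cases s <;> cases s' <;>
    simp_all [update, throughEdge, combine]
  cases t <;> rfl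

/-- The status of a vertex in the game that is called a draw if it lasts too long. -/
def horizonStatus (ω : Board) : ℕ → Vertex → Status
  | 0, _ => draw
  | n + 1, v => update (ω.1 v) (ω.2 (v, .up)) (ω.2 (v, .right))
      (horizonStatus ω n (step v .up)) (horizonStatus ω n (step v .right))

theorem horizonStatus_succ_eq {ω : Board} {n : ℕ} {v : Vertex} (h : horizonStatus ω n v ≠ draw) :
    horizonStatus ω (n + 1) v = horizonStatus ω n v := by
  induction n generalizing v with
  | zero => exact absurd rfl h
  | succ n ih => exact update_mono ih ih h

theorem horizonStatus_eq_of_le {ω : Board} {n m : ℕ} {v : Vertex} (hnm : n ≤ m)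
    (h : horizonStatus ω n v ≠ draw) : horizonStatus ω m v = horizonStatus ω n v := by
  induction m, hnm using Nat.le_induction with
  | base => rfl
  | succ m _ ih => rw [horizonStatus_succ_eq (ih ▸ h), ih]

open Classical in
/-- The status of a vertex. -/
noncomputable def status (ω : Board) (v : Vertex) : Status :=
  if ∃ n, horizonStatus ω n v = win then win
  else if ∃ n, horizonStatus ω n v = lose then lose
  else draw

theorem eventually_horizonStatus_eq (ω : Board) (v : Vertex) :
    ∃ N, ∀ n ≥ N, horizonStatus ω n v = status ω v := by
  unfold status
  split_ifs with h h'
  · obtain ⟨N, hN⟩ := h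
    exact ⟨N, fun n hn => by rw [horizonStatus_eq_of_le hn (by simp [hN]), hN]⟩
  · obtain ⟨N, hN⟩ := h'
    exact ⟨N, fun n hn => by rw [horizonStatus_eq_of_le hn (by simp [hN]), hN]⟩
  · refine ⟨0, fun n _ => ?_⟩
    cases hs : horizonStatus ω n v with
    | win => exact absurd ⟨n, hs⟩ h
    | lose => exact absurd ⟨n, hs⟩ h'
    | draw => rfl

theorem status_eq_update (ω : Board) (v : Vertex) :
    status ω v = update (ω.1 v) (ω.2 (v, .up)) (ω.2 (v, .right))
      (status ω (step v .up)) (status ω (step v .right)) := by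
  obtain ⟨N, hN⟩ := eventually_horizonStatus_eq ω v
  obtain ⟨N₁, hN₁⟩ := eventually_horizonStatus_eq ω (step v .up)
  obtain ⟨N₂, hN₂⟩ := eventually_horizonStatus_eq ω (step v .right)
  rw [← hN (max N (max N₁ N₂) + 1) (by omega), horizonStatus,
    hN₁ _ (by omega), hN₂ _ (by omega)]

/-! ### Winning strategies -/

open Classical in
/-- A move to a losing vertex, along an open edge, that loses as fast as possible (if any). -/
noncomputable def bestMove (ω : Board) (u : Vertex) : Dir :=
  if h : ∃ n d, ω.2 (u, d) = .free ∧ horizonStatus ω n (step u d) = lose then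
    (Nat.find_spec h).choose
  else .right

/-- Minimality of the horizon matters: one move, chosen without knowledge of `n`, serves every
horizon at which some move works. An arbitrary move to a losing vertex could postpone the win
forever. -/
theorem bestMove_spec {ω : Board} {u : Vertex} {n : ℕ} {d : Dir} (he : ω.2 (u, d) = .free)
    (hd : horizonStatus ω n (step u d) = lose) :
    ω.2 (u, bestMove ω u) = .free ∧ horizonStatus ω n (step u (bestMove ω u)) = lose := by
  classical
  have h : ∃ n d, ω.2 (u, d) = .free ∧ horizonStatus ω n (step u d) = lose := ⟨n, d, he, hd⟩
  have hb : bestMove ω u = (Nat.find_spec h).choose := dif_pos h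
  obtain ⟨h₁, h₂⟩ := (Nat.find_spec h).choose_spec
  rw [hb]
  refine ⟨h₁, ?_⟩
  rw [horizonStatus_eq_of_le (Nat.find_min' h ⟨d, he, hd⟩) (by simp [h₂]), h₂]

theorem position_succ' (v : Vertex) (m : ℕ → Dir) (n : ℕ) :
    position v m (n + 1) = position (step v (m 0)) (fun k => m (k + 1)) n := by
  induction n with
  | zero => rfl
  | succ n ih => rw [position, ih, position]

theorem position_eq_foldl (v : Vertex) (m : ℕ → Dir) (n : ℕ) :
    position v m n = ((List.range n).map m).foldl step v := by
  induction n with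
  | zero => rfl
  | succ n ih => simp [position, ih, List.range_succ]

theorem mover_succ (n : ℕ) : mover (n + 1) = (mover n).opponent := by
  by_cases h : Even n <;> simp [mover, Nat.even_add_one, h, Player.opponent]

/-- Winning the game that remains after an opening move along an open edge. -/
theorem wonBy_of_tail {ω : Board} {v : Vertex} {m : ℕ → Dir} {P : Player} (hv : ω.1 v = .free)
    (he : ω.2 (v, m 0) = .free) (h : WonBy ω (step v (m 0)) (fun k => m (k + 1)) P) :
    WonBy ω v m P.opponent := by
  unfold WonBy at h ⊢
  rw [hv]
  cases hl : ω.1 (step v (m 0)) with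
  | trap =>
    simp only [hl] at h
    subst h
    exact ⟨0, by simp, Or.inr ⟨Or.inr hl, rfl⟩⟩
  | target =>
    simp only [hl] at h
    subst h
    exact ⟨0, by simp, Or.inl ⟨⟨he, hl⟩, rfl⟩⟩
  | free =>
    simp only [hl] at h
    obtain ⟨n, hn, hend⟩ := h
    refine ⟨n + 1, fun k hk => ?_, ?_⟩
    · cases k with
      | zero => exact ⟨he, hl⟩
      | succ k =>
        rw [position_succ']
        exact hn k (by omega)
    · rw [position_succ', mover_succ]
      rcases hend with ⟨hw, hP⟩ | ⟨hw, hP⟩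
      · exact Or.inl ⟨hw, by rw [hP]⟩
      · exact Or.inr ⟨hw, by rw [hP]⟩

/-- Both claims are proved in one induction, because each becomes the other after one move, with the
horizon reduced by one. -/
theorem wonBy_of_bestMove (ω : Board) (n : ℕ) (v : Vertex) (m : ℕ → Dir) :
    (horizonStatus ω n v = win → (∀ k, Even k → m k = bestMove ω (position v m k)) →
      WonBy ω v m .first) ∧
    (horizonStatus ω n v = lose → (∀ k, ¬ Even k → m k = bestMove ω (position v m k)) →
      WonBy ω v m .second) := by
  induction n generalizing v m with
  | zero => exact ⟨nofun, nofun⟩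
  | succ n ih =>
    cases hl : ω.1 v with
    | trap => simp [horizonStatus, hl, update, WonBy]
    | target => simp [horizonStatus, hl, update, WonBy]
    | free =>
      obtain ⟨ih₁, ih₂⟩ := ih (step v (m 0)) (fun k => m (k + 1))
      constructor
      · intro hw hm
        obtain ⟨d, he, hd⟩ : ∃ d, ω.2 (v, d) = .free ∧ horizonStatus ω n (step v d) = lose := by
          by_contra! hcon
          have h₁ := hcon .up
          have h₂ := hcon .right
          simp only [horizonStatus, hl, update] at hw
          revert hw h₁ h₂
          cases ω.2 (v, .up) <;> cases ω.2 (v, .right) <;>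
            cases horizonStatus ω n (step v .up) <;> cases horizonStatus ω n (step v .right) <;>
            simp [throughEdge, combine]
        have h0 : m 0 = bestMove ω v := hm 0 (by simp)
        obtain ⟨he', hd'⟩ := bestMove_spec he hd
        rw [← h0] at he' hd'
        refine wonBy_of_tail (P := .second) hl he' (ih₂ hd' fun k hk => ?_)
        rw [hm (k + 1) (by simpa [Nat.even_add_one] using hk), position_succ']
      · intro hw hm
        have hcase : ∀ d, ω.2 (v, d) = .trap ∨
            ω.2 (v, d) = .free ∧ horizonStatus ω n (step v d) = win := by
          simp only [horizonStatus, hl, update] at hw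
          intro d
          revert hw
          cases d <;> cases ω.2 (v, .up) <;> cases ω.2 (v, .right) <;>
            cases horizonStatus ω n (step v .up) <;> cases horizonStatus ω n (step v .right) <;>
            simp [throughEdge, combine]
        rcases hcase (m 0) with he | ⟨he, hd⟩
        · unfold WonBy
          rw [hl]
          exact ⟨0, by simp, Or.inr ⟨Or.inl he, rfl⟩⟩
        · refine wonBy_of_tail (P := .first) hl he (ih₁ hd fun k hk => ?_)
          rw [hm (k + 1) (by simpa [Nat.even_add_one] using hk), position_succ']

theorem status_eq_draw_of_draw {ω : Board} {v : Vertex} (h : Draw ω v) : status ω v = draw := by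
  -- The same positional strategy serves either player; the position is recovered from the history.
  let σ : Strategy := fun l => bestMove ω (l.foldl step v)
  have hpos : ∀ (P : Player) (m : ℕ → Dir), Follows P σ m →
      ∀ k, mover k = P → m k = bestMove ω (position v m k) := by
    intro P m hm k hk
    rw [position_eq_foldl]
    exact hm k hk
  obtain ⟨N, hN⟩ := eventually_horizonStatus_eq ω v
  cases hs : status ω v with
  | draw => rfl
  | win =>
    refine (h .first ⟨σ, fun m hm => ?_⟩).elim
    exact (wonBy_of_bestMove ω N v m).1 ((hN N le_rfl).trans hs)
      fun k hk => hpos _ m hm k (by simp [mover, hk])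
  | lose =>
    refine (h .second ⟨σ, fun m hm => ?_⟩).elim
    exact (wonBy_of_bestMove ω N v m).2 ((hN N le_rfl).trans hs)
      fun k hk => hpos _ m hm k (by simp [mover, hk])

/-! ### Independence and translation invariance -/

instance : MeasurableSpace Status := ⊤

instance : DecidableEq VertexLabel := fun a b => by
  cases a <;> cases b <;> first | exact isTrue rfl | exact isFalse nofun

instance : DecidableEq EdgeLabel := fun a b => by
  cases a <;> cases b <;> first | exact isTrue rfl | exact isFalse nofun

instance : Fintype VertexLabel :=
  ⟨{.trap, .target, .free}, fun a => by cases a <;> decide⟩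

instance : Fintype EdgeLabel := ⟨{.trap, .free}, fun a => by cases a <;> decide⟩

instance : DiscreteMeasurableSpace VertexLabel := ⟨fun _ => trivial⟩

instance : DiscreteMeasurableSpace EdgeLabel := ⟨fun _ => trivial⟩

instance : DiscreteMeasurableSpace Status := ⟨fun _ => trivial⟩

/-- The σ-algebra generated by the label of one vertex or of one edge. -/
@[reducible]
def labelSigma : Vertex ⊕ Edge → MeasurableSpace Board
  | .inl v => MeasurableSpace.comap (fun ω => ω.1 v) ⊤
  | .inr e => MeasurableSpace.comap (fun ω => ω.2 e) ⊤

theorem labelSigma_le (i : Vertex ⊕ Edge) :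
    labelSigma i ≤ (inferInstance : MeasurableSpace Board) := by
  cases i with
  | inl v => exact Measurable.comap_le ((measurable_pi_apply v).comp measurable_fst)
  | inr e => exact Measurable.comap_le ((measurable_pi_apply e).comp measurable_snd)

theorem boardLaw_prod_pi (θ : Theta) (s : Finset Vertex) (s' : Finset Edge)
    (t : Vertex → Set VertexLabel) (t' : Edge → Set EdgeLabel) :
    boardLaw θ ((s : Set Vertex).pi t ×ˢ (s' : Set Edge).pi t') =
      (∏ v ∈ s, vertexLaw θ (t v)) * ∏ e ∈ s', edgeLaw θ (t' e) := by
  rw [boardLaw, Measure.prod_prod, Measure.infinitePi_pi _ fun _ _ => .of_discrete,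
    Measure.infinitePi_pi _ fun _ _ => .of_discrete]

/-- Every event of `labelSigma i` restricts a single coordinate, so a finite intersection of such
events is a box, and product measures factorise on boxes. -/
theorem iIndep_labelSigma (θ : Theta) : iIndep labelSigma (boardLaw θ) := by
  classical
  rw [iIndep_iff]
  intro s f hf
  have hl : ∀ v, ∃ t : Set VertexLabel, Sum.inl v ∈ s → f (.inl v) = {ω | ω.1 v ∈ t} := by
    intro v
    by_cases hv : Sum.inl v ∈ s
    · obtain ⟨t, -, ht⟩ := hf _ hv
      exact ⟨t, fun _ => ht.symm⟩
    · exact ⟨∅, fun h => absurd h hv⟩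
  have hr : ∀ e, ∃ t : Set EdgeLabel, Sum.inr e ∈ s → f (.inr e) = {ω | ω.2 e ∈ t} := by
    intro e
    by_cases he : Sum.inr e ∈ s
    · obtain ⟨t, -, ht⟩ := hf _ he
      exact ⟨t, fun _ => ht.symm⟩
    · exact ⟨∅, fun h => absurd h he⟩
  choose t ht using hl
  choose t' ht' using hr
  have hv : ∀ v, boardLaw θ {ω | ω.1 v ∈ t v} = vertexLaw θ (t v) := by
    intro v
    simpa [Set.prod_univ, Set.preimage] using boardLaw_prod_pi θ {v} ∅ t t'
  have he : ∀ e, boardLaw θ {ω | ω.2 e ∈ t' e} = edgeLaw θ (t' e) := by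
    intro e
    simpa [Set.univ_prod, Set.preimage] using boardLaw_prod_pi θ ∅ {e} t t'
  have hset : ⋂ i ∈ s, f i = (s.toLeft : Set Vertex).pi t ×ˢ (s.toRight : Set Edge).pi t' := by
    ext ω
    simp only [Set.mem_iInter, Sum.forall, Set.mem_prod, Set.mem_pi, Finset.mem_coe,
      Finset.mem_toLeft, Finset.mem_toRight]
    refine and_congr (forall₂_congr fun v h => ?_) (forall₂_congr fun e h => ?_)
    · rw [ht v h]; rfl
    · rw [ht' e h]; rfl
  rw [hset, boardLaw_prod_pi]
  conv_rhs => rw [← Finset.toLeft_disjSum_toRight (u := s), Finset.prod_disjSum]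
  congr 1
  · refine Finset.prod_congr rfl fun v h => ?_
    rw [ht v (by simpa using h), hv]
  · refine Finset.prod_congr rfl fun e h => ?_
    rw [ht' e (by simpa using h), he]

/-- The board seen from the vertex `k`. -/
def shift (k : Vertex) (ω : Board) : Board :=
  (fun v => ω.1 (v + k), fun e => ω.2 (e.1 + k, e.2))

theorem measurePreserving_reindex {ι X : Type*} [MeasurableSpace X] (μ : Measure X)
    [IsProbabilityMeasure μ] (e : ι ≃ ι) :
    MeasurePreserving (fun (x : ι → X) i => x (e i)) (Measure.infinitePi fun _ => μ)
      (Measure.infinitePi fun _ => μ) := by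
  classical
  refine ⟨by fun_prop, Measure.eq_infinitePi _ fun s t ht => ?_⟩
  rw [Measure.map_apply (by fun_prop) (.pi s.countable_toSet fun i _ => ht i)]
  have : (fun (x : ι → X) i => x (e i)) ⁻¹' (s : Set ι).pi t =
      ((s.map e.toEmbedding : Finset ι) : Set ι).pi fun i => t (e.symm i) := by
    ext x
    simp only [Set.mem_preimage, Set.mem_pi, Finset.mem_coe, Finset.mem_map_equiv]
    exact ⟨fun h i hi => by simpa using h _ hi, fun h i hi => by simpa using h (e i) (by simpa)⟩
  rw [this, Measure.infinitePi_pi _ fun i _ => ht _]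
  simp

theorem measurePreserving_shift (θ : Theta) (k : Vertex) :
    MeasurePreserving (shift k) (boardLaw θ) (boardLaw θ) :=
  (measurePreserving_reindex (vertexLaw θ) (Equiv.addRight k)).prod
    (measurePreserving_reindex (edgeLaw θ) ((Equiv.addRight k).prodCongr (Equiv.refl Dir)))

theorem step_add (v k : Vertex) (d : Dir) : step (v + k) d = step v d + k := by
  cases d <;> ext <;> simp [step, add_right_comm]

theorem horizonStatus_shift (k : Vertex) (ω : Board) (n : ℕ) (v : Vertex) :
    horizonStatus (shift k ω) n v = horizonStatus ω n (v + k) := by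
  induction n generalizing v with
  | zero => rfl
  | succ n ih => rw [horizonStatus, horizonStatus, ih, ih, step_add, step_add]; rfl

theorem status_shift (k : Vertex) (ω : Board) (v : Vertex) :
    status (shift k ω) v = status ω (v + k) := by
  unfold status
  split_ifs <;> simp_all [horizonStatus_shift]

/-- The labels of the vertices on or above the antidiagonal `x + y = n` and of the edges starting
there. -/
def upperLabels (n : ℤ) : Set (Vertex ⊕ Edge) :=
  {i | Sum.elim (fun v => n ≤ v.1 + v.2) (fun e => n ≤ e.1.1 + e.1.2) i}

/-- The label of a vertex and the labels of the two edges starting there. -/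
def siteLabels (v : Vertex) : Set (Vertex ⊕ Edge) :=
  {.inl v, .inr (v, .up), .inr (v, .right)}

theorem measurable_vertexLabel {S : Set (Vertex ⊕ Edge)} {v : Vertex} (h : .inl v ∈ S) :
    Measurable[⨆ i ∈ S, labelSigma i] fun ω : Board => ω.1 v :=
  (comap_measurable _).mono (le_iSup₂_of_le (f := fun i _ => labelSigma i) _ h le_rfl) le_rfl

theorem measurable_edgeLabel {S : Set (Vertex ⊕ Edge)} {e : Edge} (h : .inr e ∈ S) :
    Measurable[⨆ i ∈ S, labelSigma i] fun ω : Board => ω.2 e :=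
  (comap_measurable _).mono (le_iSup₂_of_le (f := fun i _ => labelSigma i) _ h le_rfl) le_rfl

/-- The token never goes back to a lower antidiagonal. This locality makes the statuses on one
antidiagonal independent of the labels on the one below. -/
theorem measurable_horizonStatus {N : ℤ} (n : ℕ) {v : Vertex} (hv : N ≤ v.1 + v.2) :
    Measurable[⨆ i ∈ upperLabels N, labelSigma i] fun ω : Board => horizonStatus ω n v := by
  induction n generalizing v with
  | zero => exact measurable_const
  | succ n ih =>
    have hF : Measurable fun x : VertexLabel × EdgeLabel × EdgeLabel × Status × Status =>
        update x.1 x.2.1 x.2.2.1 x.2.2.2.1 x.2.2.2.2 := .of_discrete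
    refine hF.comp (Measurable.prodMk (measurable_vertexLabel hv)
      (Measurable.prodMk (measurable_edgeLabel hv) (Measurable.prodMk (measurable_edgeLabel hv)
        (Measurable.prodMk (ih ?_) (ih ?_))))) <;> simp only [step] <;> omega

theorem measurable_status {N : ℤ} {v : Vertex} (hv : N ≤ v.1 + v.2) :
    Measurable[⨆ i ∈ upperLabels N, labelSigma i] fun ω : Board => status ω v := by
  have h : ∀ s : Status, MeasurableSet[⨆ i ∈ upperLabels N, labelSigma i]
      {ω : Board | ∃ n, horizonStatus ω n v = s} := by
    intro s
    rw [Set.ofPred_exists]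
    exact MeasurableSet.iUnion fun n => measurable_horizonStatus n hv (measurableSet_singleton s)
  exact Measurable.ite (h win) measurable_const
    (Measurable.ite (h lose) measurable_const measurable_const)

/-! ### The transition from one antidiagonal to the next -/

theorem sum_vertexLabel {M : Type*} [AddCommMonoid M] (f : VertexLabel → M) :
    ∑ l, f l = f .trap + f .target + f .free := by
  rw [show (Finset.univ : Finset VertexLabel) = {.trap, .target, .free} from rfl,
    Finset.sum_insert (by decide), Finset.sum_pair (by decide), add_assoc]

theorem sum_edgeLabel {M : Type*} [AddCommMonoid M] (f : EdgeLabel → M) :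
    ∑ e, f e = f .trap + f .free := by
  rw [show (Finset.univ : Finset EdgeLabel) = {.trap, .free} from rfl,
    Finset.sum_pair (by decide)]

theorem sum_status {M : Type*} [AddCommMonoid M] (f : Status → M) :
    ∑ s, f s = f win + f lose + f draw := by
  rw [show (Finset.univ : Finset Status) = {.win, .lose, .draw} from rfl,
    Finset.sum_insert (by decide), Finset.sum_pair (by decide), add_assoc]

/-- The probability of a vertex label. -/
def vertexProb (p q : ℝ) : VertexLabel → ℝ
  | .trap => p
  | .target => q
  | .free => 1 - p - q

/-- The probability of an edge label. -/
def edgeProb (r : ℝ) : EdgeLabel → ℝ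
  | .trap => r
  | .free => 1 - r

theorem vertexLaw_real_singleton {p q r : ℝ} (hθ : (p, q, r) ∈ Theta) (l : VertexLabel) :
    (vertexLaw ⟨(p, q, r), hθ⟩).real {l} = vertexProb p q l := by
  obtain ⟨hp, hq, hr, -, hpq⟩ := hθ
  have h1 : 0 ≤ p := hp.1
  have h2 : 0 ≤ q := hq.1
  have h3 : 0 ≤ 1 - p - q := by have : p + q ≤ 1 := hpq; linarith
  cases l <;> simp [vertexLaw, measureReal_def, vertexProb, h1, h2, h3]

theorem edgeLaw_real_singleton {p q r : ℝ} (hθ : (p, q, r) ∈ Theta) (e : EdgeLabel) :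
    (edgeLaw ⟨(p, q, r), hθ⟩).real {e} = edgeProb r e := by
  obtain ⟨hp, hq, hr, -, hpq⟩ := hθ
  have h1 : 0 ≤ r := hr.1
  have h2 : 0 ≤ 1 - r := by have : r ≤ 1 := hr.2; linarith
  cases e <;> simp [edgeLaw, measureReal_def, edgeProb, h1, hr.2]

/-- The probability that a vertex has status `t`, given the statuses of its two successors. -/
noncomputable def transition (p q r : ℝ) (s s' t : Status) : ℝ :=
  ∑ x : VertexLabel × EdgeLabel × EdgeLabel,
    if update x.1 x.2.1 x.2.2 s s' = t then
      vertexProb p q x.1 * (edgeProb r x.2.1 * edgeProb r x.2.2) else 0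

/-- The labels at a vertex force the status `t`, given the statuses of its two successors. -/
def siteEvent (v : Vertex) (s s' t : Status) : Set Board :=
  {ω | update (ω.1 v) (ω.2 (v, .up)) (ω.2 (v, .right)) s s' = t}

theorem measurableSet_siteEvent (v : Vertex) (s s' t : Status) :
    MeasurableSet[⨆ i ∈ siteLabels v, labelSigma i] (siteEvent v s s' t) := by
  have hF : Measurable fun x : VertexLabel × EdgeLabel × EdgeLabel =>
      update x.1 x.2.1 x.2.2 s s' := .of_discrete
  exact (hF.comp (Measurable.prodMk (measurable_vertexLabel (by simp [siteLabels]))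
    (Measurable.prodMk (measurable_edgeLabel (by simp [siteLabels]))
      (measurable_edgeLabel (by simp [siteLabels]))))) (measurableSet_singleton t)

theorem boardLaw_real_siteLabels {p q r : ℝ} (hθ : (p, q, r) ∈ Theta) (v : Vertex)
    (x : VertexLabel × EdgeLabel × EdgeLabel) :
    (boardLaw ⟨(p, q, r), hθ⟩).real
      ((fun ω : Board => (ω.1 v, ω.2 (v, .up), ω.2 (v, .right))) ⁻¹' {x}) =
      vertexProb p q x.1 * (edgeProb r x.2.1 * edgeProb r x.2.2) := by
  classical
  obtain ⟨l, e, e'⟩ := x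
  have hne : ((v, Dir.up) : Edge) ≠ (v, Dir.right) := by simp
  have hset : (fun ω : Board => (ω.1 v, ω.2 (v, .up), ω.2 (v, .right))) ⁻¹' {(l, e, e')} =
      (({v} : Finset Vertex) : Set Vertex).pi (fun _ => {l}) ×ˢ
        (({(v, .up), (v, .right)} : Finset Edge) : Set Edge).pi
          (fun f => if f = (v, .up) then {e} else {e'}) := by
    ext ω
    simp
  rw [hset, measureReal_def, boardLaw_prod_pi, Finset.prod_singleton, Finset.prod_pair hne,
    if_pos rfl, if_neg hne.symm, ENNReal.toReal_mul, ENNReal.toReal_mul]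
  simp only [← measureReal_def, vertexLaw_real_singleton, edgeLaw_real_singleton]

theorem boardLaw_real_siteEvent {p q r : ℝ} (hθ : (p, q, r) ∈ Theta) (v : Vertex)
    (s s' t : Status) :
    (boardLaw ⟨(p, q, r), hθ⟩).real (siteEvent v s s' t) = transition p q r s s' t := by
  have hm : Measurable fun ω : Board => (ω.1 v, ω.2 (v, .up), ω.2 (v, .right)) := by fun_prop
  have hset : siteEvent v s s' t = (fun ω : Board => (ω.1 v, ω.2 (v, .up), ω.2 (v, .right))) ⁻¹'
      ((Finset.univ.filter fun x : VertexLabel × EdgeLabel × EdgeLabel =>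
        update x.1 x.2.1 x.2.2 s s' = t : Finset _) : Set _) := by
    ext ω
    simp [siteEvent]
  rw [hset, ← sum_measureReal_preimage_singleton _ fun _ _ => hm (measurableSet_singleton _),
    transition, Finset.sum_filter]
  simp only [boardLaw_real_siteLabels]

theorem boardLaw_real_inter {θ : Theta} {S T : Set (Vertex ⊕ Edge)} {A B : Set Board}
    (hST : Disjoint S T) (hA : MeasurableSet[⨆ i ∈ S, labelSigma i] A)
    (hB : MeasurableSet[⨆ i ∈ T, labelSigma i] B) :
    (boardLaw θ).real (A ∩ B) = (boardLaw θ).real A * (boardLaw θ).real B := by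
  rw [measureReal_def, (Indep_iff _ _ _).1 (indep_iSup_of_disjoint labelSigma_le
    (iIndep_labelSigma θ) hST) A B hA hB, ENNReal.toReal_mul, measureReal_def, measureReal_def]

theorem measurableSet_mono_labels {S T : Set (Vertex ⊕ Edge)} {A : Set Board} (hST : S ⊆ T)
    (hA : MeasurableSet[⨆ i ∈ S, labelSigma i] A) : MeasurableSet[⨆ i ∈ T, labelSigma i] A :=
  (biSup_mono hST : ⨆ i ∈ S, labelSigma i ≤ ⨆ i ∈ T, labelSigma i) A hA

theorem iSup_labelSigma_le (S : Set (Vertex ⊕ Edge)) :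
    ⨆ i ∈ S, labelSigma i ≤ (inferInstance : MeasurableSpace Board) :=
  iSup₂_le fun i _ => labelSigma_le i

/-- The `i`-th vertex to the right of `v` on its antidiagonal. -/
def diag (v : Vertex) (i : ℤ) : Vertex := (v.1 + i, v.2 - i)

/-- The statuses of three consecutive vertices of an antidiagonal. -/
noncomputable def triple (v : Vertex) (ω : Board) : Status × Status × Status :=
  (status ω (diag v 0), status ω (diag v 1), status ω (diag v 2))

/-- The statuses of four consecutive vertices of an antidiagonal. -/
noncomputable def quadruple (v : Vertex) (ω : Board) : Status × Status × Status × Status :=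
  (status ω (diag v 0), status ω (diag v 1), status ω (diag v 2), status ω (diag v 3))

theorem measurable_quadruple {N : ℤ} {v : Vertex} (hv : N ≤ v.1 + v.2) :
    Measurable[⨆ i ∈ upperLabels N, labelSigma i] (quadruple v) := by
  refine Measurable.prodMk (measurable_status ?_) (Measurable.prodMk (measurable_status ?_)
    (Measurable.prodMk (measurable_status ?_) (measurable_status ?_))) <;>
    simp only [diag] <;> omega

theorem boardLaw_real_quadruple_inter {p q r : ℝ} (hθ : (p, q, r) ∈ Theta) (v : Vertex)
    (w : Status × Status × Status × Status) (t : Status × Status × Status) :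
    (boardLaw ⟨(p, q, r), hθ⟩).real (quadruple (step v .up) ⁻¹' {w} ∩ triple v ⁻¹' {t}) =
      (boardLaw ⟨(p, q, r), hθ⟩).real (quadruple (step v .up) ⁻¹' {w}) *
        (transition p q r w.1 w.2.1 t.1 * transition p q r w.2.1 w.2.2.1 t.2.1 *
          transition p q r w.2.2.1 w.2.2.2 t.2.2) := by
  obtain ⟨a, b, c, d⟩ := w
  obtain ⟨t₀, t₁, t₂⟩ := t
  have hu : ∀ i, step (diag v i) .up = diag (step v .up) i := fun i => by
    simp only [step, diag]; congr 1; ring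
  have hr : ∀ i, step (diag v i) .right = diag (step v .up) (i + 1) := fun i => by
    simp only [step, diag]; congr 1 <;> ring
  -- Once the upper statuses are fixed, the recursion turns the lower ones into conditions on the
  -- labels at three sites. These use disjoint label sets, also disjoint from the labels that
  -- determine the upper statuses.
  have hset : quadruple (step v .up) ⁻¹' {(a, b, c, d)} ∩ triple v ⁻¹' {(t₀, t₁, t₂)} =
      siteEvent (diag v 0) a b t₀ ∩ (siteEvent (diag v 1) b c t₁ ∩
        (siteEvent (diag v 2) c d t₂ ∩ quadruple (step v .up) ⁻¹' {(a, b, c, d)})) := by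
    ext ω
    simp only [Set.mem_inter_iff, Set.mem_preimage, Set.mem_singleton_iff, quadruple, triple,
      Prod.mk.injEq, siteEvent, Set.mem_ofPred_eq, status_eq_update ω (diag v _), hu, hr]
    norm_num
    constructor
    · rintro ⟨⟨rfl, rfl, rfl, rfl⟩, h₀, h₁, h₂⟩
      exact ⟨h₀, h₁, h₂, rfl, rfl, rfl, rfl⟩
    · rintro ⟨h₀, h₁, h₂, rfl, rfl, rfl, rfl⟩
      exact ⟨⟨rfl, rfl, rfl, rfl⟩, h₀, h₁, h₂⟩
  have hB : MeasurableSet[⨆ i ∈ upperLabels (v.1 + v.2 + 1), labelSigma i]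
      (quadruple (step v .up) ⁻¹' {(a, b, c, d)}) :=
    measurable_quadruple (by simp only [step]; omega) (measurableSet_singleton _)
  have hsite : ∀ i, Disjoint (siteLabels (diag v i)) (upperLabels (v.1 + v.2 + 1)) := by
    intro i
    rw [Set.disjoint_left]
    rintro x (rfl | rfl | rfl) <;> simp only [upperLabels, diag, Set.mem_ofPred_eq,
      Sum.elim_inl, Sum.elim_inr] <;> omega
  have hdisj : ∀ i j, i ≠ j → Disjoint (siteLabels (diag v i)) (siteLabels (diag v j)) := by
    intro i j hij
    rw [Set.disjoint_left]
    rintro x (rfl | rfl | rfl) <;> simp [siteLabels, diag, hij]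
  have h₂ := (measurableSet_mono_labels (Set.subset_union_left (t := upperLabels _))
    (measurableSet_siteEvent (diag v 2) c d t₂)).inter
    (measurableSet_mono_labels (Set.subset_union_right (s := siteLabels (diag v 2))) hB)
  have h₁ := (measurableSet_mono_labels Set.subset_union_left
    (measurableSet_siteEvent (diag v 1) b c t₁)).inter
    (measurableSet_mono_labels (Set.subset_union_right (s := siteLabels (diag v 1))) h₂)
  rw [hset, boardLaw_real_inter _ (measurableSet_siteEvent _ _ _ _) h₁,
    boardLaw_real_inter _ (measurableSet_siteEvent _ _ _ _) h₂,
    boardLaw_real_inter (hsite 2) (measurableSet_siteEvent _ _ _ _) hB,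
    boardLaw_real_siteEvent, boardLaw_real_siteEvent, boardLaw_real_siteEvent]
  · ring
  · exact Set.disjoint_union_right.2 ⟨hdisj _ _ (by norm_num), hsite 1⟩
  · exact Set.disjoint_union_right.2 ⟨hdisj _ _ (by norm_num),
      Set.disjoint_union_right.2 ⟨hdisj _ _ (by norm_num), hsite 0⟩⟩

/-! ### The drift inequality -/

/-- Upper bound for the probability of becoming a draw. -/
def drawBound (p q r : ℝ) : Status → Status → ℝ
  | draw, draw => 1 - p - q
  | draw, win => (1 - p - q) * (1 - r)
  | win, draw => (1 - p - q) * (1 - r)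
  | draw, lose => (1 - p - q) * r * (1 - r)
  | lose, draw => (1 - p - q) * r * (1 - r)
  | _, _ => 0

/-- Upper bound for the probability of becoming a win. -/
def winBound (p q r : ℝ) : Status → Status → ℝ
  | lose, lose => 1 - q
  | lose, _ => 1 - q - (1 - p - q) * r
  | _, lose => 1 - q - (1 - p - q) * r
  | _, _ => p

/-- Upper bound for the probability of becoming a loss. -/
def loseBound (p q r : ℝ) : Status → Status → ℝ
  | win, win => 1 - p
  | win, _ => q + r
  | _, win => q + r
  | _, _ => q + r ^ 2

/-- Local potential of three consecutive statuses on an antidiagonal; it charges the draws and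
penalises the neighbourhoods from which draws spread. -/
noncomputable def weight (p r : ℝ) : Status → Status → Status → ℝ
  | a, b, c => (if b = draw then 1 + 3 * r else 0)
    + (if (a = win ∧ b = draw) ∨ (a = draw ∧ b = win) then 1 / 4 + p else 0)
    + (if (b = win ∧ c = draw) ∨ (b = draw ∧ c = win) then 1 / 4 + p else 0)
    + (if a = draw ∧ b = draw then p else 0) + (if b = draw ∧ c = draw then p else 0)
    + (if (a = lose ∧ b = win ∧ c = draw) ∨ (a = draw ∧ b = win ∧ c = lose) then 1 / 2 else 0)

/-- Telescoping term that balances the potential between overlapping triples. -/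
noncomputable def corrector (p q r : ℝ) : Status → Status → Status → ℝ
  | win, win, draw => -1 / 8 + p / 4
  | draw, win, win => 1 / 8 - p / 4
  | win, lose, draw => 3 / 4 * r
  | draw, lose, win => -(3 / 4 * r)
  | win, draw, lose => 3 / 8 - p / 4 - q
  | lose, draw, win => -3 / 8 + p / 4 + q
  | win, draw, draw => 1 / 8
  | draw, draw, win => -1 / 8
  | lose, win, draw => -1 / 8 + p / 4
  | draw, win, lose => 1 / 8 - p / 4
  | lose, lose, draw => 5 / 4 * r
  | draw, lose, lose => -(5 / 4 * r)
  | lose, draw, draw => -1 / 4 + p / 4 + 19 / 20 * q + r / 4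
  | draw, draw, lose => 1 / 4 - p / 4 - 19 / 20 * q - r / 4
  | _, _, _ => 0

/-- Expected weight of the three sites that are fed by the statuses `a, b, c, d`, if two adjacent
statuses `s, s'` produce a draw, a win and a loss with probabilities `u s s'`, `z s s'` and
`o s s'`. -/
noncomputable def nextWeight (p r : ℝ) (u z o : Status → Status → ℝ) (a b c d : Status) : ℝ :=
  (1 + 3 * r) * u b c
    + (1 / 4 + p) * (z a b * u b c + u a b * z b c + z b c * u c d + u b c * z c d)
    + p * (u a b * u b c + u b c * u c d)
    + 1 / 2 * (o a b * z b c * u c d + u a b * z b c * o c d)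

/-- Decrease of the potential on the word `a, b, c, d` in one step, up to telescoping terms, beyond
a positive multiple of the number of draws in the middle of the word. -/
noncomputable def driftGap (p q r : ℝ) (a b c d : Status) : ℝ :=
  (weight p r a b c + weight p r b c d) / 2 - corrector p q r a b c + corrector p q r b c d
    - (q + p ^ 2) / 50 * ((if b = draw then 1 else 0) + (if c = draw then 1 else 0))
    - nextWeight p r (drawBound p q r) (winBound p q r) (loseBound p q r) a b c d

/-- The weights and the transition bounds are invariant under reflection, while `corrector` is odd
and enters as a difference. This nearly halves the case analysis. -/
theorem driftGap_symm (p q r : ℝ) (a b c d : Status) :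
    driftGap p q r a b c d = driftGap p q r d c b a := by
  have hu : ∀ x y, drawBound p q r x y = drawBound p q r y x := by
    intro x y; cases x <;> cases y <;> rfl
  have hz : ∀ x y, winBound p q r x y = winBound p q r y x := by
    intro x y; cases x <;> cases y <;> rfl
  have ho : ∀ x y, loseBound p q r x y = loseBound p q r y x := by
    intro x y; cases x <;> cases y <;> rfl
  have hw : ∀ x y z, weight p r x y z = weight p r z y x := by
    intro x y z; cases x <;> cases y <;> cases z <;> simp [weight]
  have hc : ∀ x y z, corrector p q r x y z = -corrector p q r z y x := by
    intro x y z
    cases x <;> cases y <;> cases z <;> simp only [corrector] <;> ring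
  rw [driftGap, driftGap, hw a b c, hw b c d, hc a b c, hc b c d]
  simp only [nextWeight]
  rw [hu d c, hu c b, hu b a, hz d c, hz c b, hz b a, ho d c, ho b a]
  ring

/-- Here and in the five lemmas that follow, each gap is a sum of slacks `1/50 - p`, `1/50 - q`,
`1/50 - r` (and `7/4 * q + p ^ 2 - r` where it is needed) times polynomials with nonnegative
coefficients, plus one more such polynomial. The hints are these certificates. -/
theorem driftGap_nonneg_win_win {p q r : ℝ} (hp : 0 ≤ p) (hq : 0 ≤ q) (hr : 0 ≤ r)
    (hp' : 0 ≤ 1 / 50 - p) (hq' : 0 ≤ 1 / 50 - q) (hr' : 0 ≤ 1 / 50 - r)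
    (a d : Status) :
    0 ≤ driftGap p q r a win win d := by
  -- The entry `-1/8 + p/4` of `corrector` makes the linear terms cancel here: `(1/4 + p)/2 - 1/8 +
  -- p/4 = 3p/4` is the linear part of the next weight.
  have : 0 ≤ driftGap p q r win win win draw := by
    simp [driftGap, nextWeight, weight, corrector, drawBound, winBound, loseBound]
    linarith [mul_nonneg hp' (show 0 ≤ 1 / 4 * p * r by positivity), mul_nonneg hr' (show 0 ≤ 3 /
      4 * p * q + 1 / 2 * p ^ 3 + 1 / 2 * p ^ 2 * q by positivity), show 0 ≤ 1 / 4 * p ^ 2 + 147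
      / 200 * p * q + 149 / 200 * p * r + 49 / 100 * p ^ 3 + 49 / 100 * p ^ 2 * q by positivity]
  have : 0 ≤ driftGap p q r lose win win draw := by
    simp [driftGap, nextWeight, weight, corrector, drawBound, winBound, loseBound]
    linarith [mul_nonneg hp' (show 0 ≤ 3 / 4 * p + p ^ 2 * r by positivity), mul_nonneg hq' (show
      0 ≤ 1 / 4 * p + 1 / 2 * p * q * r by positivity), mul_nonneg hr' (show 0 ≤ 1 / 4 * p + 3 /
      2 * p ^ 2 * q + 1 / 2 * p ^ 2 * r + 1 / 2 * p * q * r by positivity), show 0 ≤ 19 / 40 * p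
      + p ^ 3 + 147 / 100 * p ^ 2 * q + 61 / 50 * p ^ 2 * r + 1 / 2 * p * q ^ 2 + 73 / 100 * p *
      q * r + 1 / 2 * p * r ^ 2 by positivity]
  have : 0 ≤ driftGap p q r draw win win draw := by
    simp [driftGap, nextWeight, weight, corrector, drawBound, winBound, loseBound]
    linarith [mul_nonneg hp' (show 0 ≤ 3 / 2 * p + 2 * p ^ 2 * r by positivity), mul_nonneg hq'
      (show 0 ≤ 1 / 2 * p + p * q * r by positivity), mul_nonneg hr' (show 0 ≤ 1 / 2 * p + 3 * p
      ^ 2 * q + p ^ 2 * r + p * q * r by positivity), show 0 ≤ 19 / 20 * p + 2 * p ^ 3 + 147 / 50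
      * p ^ 2 * q + 61 / 25 * p ^ 2 * r + p * q ^ 2 + 73 / 50 * p * q * r + p * r ^ 2 by
      positivity]
  -- Words without a draw have gap zero, since every term of the gap involves a draw.
  rcases a with _ | _ | _ <;> rcases d with _ | _ | _ <;>
    first
    | assumption
    | (rw [driftGap_symm]; assumption)
    | simp [driftGap, nextWeight, weight, corrector, drawBound]

theorem driftGap_nonneg_win_lose {p q r : ℝ} (hp : 0 ≤ p) (hq : 0 ≤ q) (hr : 0 ≤ r)
    (hp' : 0 ≤ 1 / 50 - p) (hq' : 0 ≤ 1 / 50 - q) (hr' : 0 ≤ 1 / 50 - r)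
    (a d : Status) :
    0 ≤ driftGap p q r a win lose d := by
  have : 0 ≤ driftGap p q r win win lose draw := by
    simp [driftGap, nextWeight, weight, corrector, drawBound, winBound, loseBound]
    linarith [mul_nonneg hp' (show 0 ≤ 5 / 4 * r ^ 2 + 1 / 2 * q * r ^ 3 by positivity),
      mul_nonneg hq' (show 0 ≤ 3 / 4 * q * r + 1 / 2 * p ^ 2 * r + 1 / 2 * p * q * r by
      positivity), mul_nonneg hr' (show 0 ≤ 3 * q * r + 3 / 4 * r ^ 2 + 3 / 4 * p ^ 2 * r + 3 / 4
      * q ^ 2 * r ^ 2 + 1 / 2 * p ^ 3 * r ^ 2 + p ^ 2 * q * r ^ 2 + 1 / 2 * p * q ^ 2 * r ^ 2 by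
      positivity), show 0 ≤ 1 / 4 * p * r + 57 / 40 * q * r + 73 / 50 * r ^ 2 + 19 / 40 * p ^ 2 *
      r + 6 / 25 * p * q * r + 1 / 4 * p * q * r ^ 2 + p * r ^ 3 + 297 / 200 * q ^ 2 * r ^ 2 +
      149 / 100 * q * r ^ 3 + 49 / 100 * p ^ 3 * r ^ 2 + 37 / 25 * p ^ 2 * q * r ^ 2 + 1 / 4 * p
      ^ 2 * r ^ 3 + 99 / 100 * p * q ^ 2 * r ^ 2 by positivity]
  have : 0 ≤ driftGap p q r lose win lose draw := by
    simp [driftGap, nextWeight, weight, corrector, drawBound, winBound, loseBound]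
    linarith [mul_nonneg hp' (show 0 ≤ 3 / 4 * r + p * q * r + 11 / 4 * p * r ^ 2 + p ^ 2 * r ^ 3
      + 5 / 2 * p * q * r ^ 3 by positivity), mul_nonneg hq' (show 0 ≤ 3 / 2 * p * q * r + 1 / 2
      * q ^ 2 * r + 2 * q * r ^ 2 + 2 * p * q * r ^ 3 + 1 / 2 * q ^ 2 * r ^ 3 by positivity),
      mul_nonneg hr' (show 0 ≤ 21 / 4 * p * q * r + 2 * p * r ^ 2 + 2 * q * r ^ 2 + 1 / 2 * r ^ 3
      + 1 / 2 * p ^ 2 * r ^ 3 + p * q * r ^ 3 + 1 / 2 * q ^ 2 * r ^ 3 by positivity), show 0 ≤ 97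
      / 200 * r + p ^ 2 * r + 419 / 200 * p * q * r + 331 / 200 * p * r ^ 2 + 37 / 50 * q ^ 2 * r
      + 23 / 25 * q * r ^ 2 + 37 / 50 * r ^ 3 + p ^ 3 * r ^ 2 + 7 / 2 * p ^ 2 * q * r ^ 2 + 111 /
      50 * p ^ 2 * r ^ 3 + 7 / 2 * p * q ^ 2 * r ^ 2 + 389 / 100 * p * q * r ^ 3 + p * r ^ 4 + q
      ^ 3 * r ^ 2 + 173 / 100 * q ^ 2 * r ^ 3 + q * r ^ 4 by positivity]
  have : 0 ≤ driftGap p q r draw win lose win := by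
    simp [driftGap, nextWeight, weight, corrector, drawBound, winBound, loseBound]
    linarith [mul_nonneg hp' (show 0 ≤ p * q + 11 / 4 * p * r + p ^ 2 * r ^ 2 + 5 / 2 * p * q * r
      ^ 2 by positivity), mul_nonneg hq' (show 0 ≤ 3 / 2 * p * q + 1 / 2 * q ^ 2 + 2 * q * r + 2
      * p * q * r ^ 2 + 1 / 2 * q ^ 2 * r ^ 2 by positivity), mul_nonneg hr' (show 0 ≤ 21 / 4 * p
      * q + 2 * p * r + 2 * q * r + 1 / 2 * r ^ 2 + 1 / 2 * p ^ 2 * r ^ 2 + p * q * r ^ 2 + 1 / 2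
      * q ^ 2 * r ^ 2 by positivity), show 0 ≤ p ^ 2 + 419 / 200 * p * q + 331 / 200 * p * r + 37
      / 50 * q ^ 2 + 23 / 25 * q * r + 37 / 50 * r ^ 2 + p ^ 3 * r + 7 / 2 * p ^ 2 * q * r + 111
      / 50 * p ^ 2 * r ^ 2 + 7 / 2 * p * q ^ 2 * r + 389 / 100 * p * q * r ^ 2 + p * r ^ 3 + q ^
      3 * r + 173 / 100 * q ^ 2 * r ^ 2 + q * r ^ 3 by positivity]
  have : 0 ≤ driftGap p q r draw win lose lose := by
    simp [driftGap, nextWeight, weight, corrector, drawBound, winBound, loseBound]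
    linarith [mul_nonneg hp' (show 0 ≤ p * q + 11 / 4 * p * r + 3 / 2 * r ^ 3 + p ^ 2 * r ^ 2 + 1
      / 2 * p * r ^ 4 by positivity), mul_nonneg hq' (show 0 ≤ 3 / 2 * p * q + 1 / 2 * q ^ 2 + 1
      / 2 * q * r ^ 4 by positivity), mul_nonneg hr' (show 0 ≤ 3 / 4 * r + 19 / 4 * p * q + 3 / 2
      * q ^ 2 + 2 * q * r ^ 2 + 1 / 2 * r ^ 3 + 5 / 2 * p ^ 2 * q * r + 2 * p * q ^ 2 * r + 1 / 2
      * q ^ 3 * r + p * q * r ^ 3 by positivity), show 0 ≤ 97 / 200 * r + p ^ 2 + 421 / 200 * p *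
      q + 239 / 200 * p * r + 71 / 100 * q ^ 2 + 24 / 25 * q * r ^ 2 + 24 / 25 * r ^ 3 + p ^ 3 *
      r + 69 / 20 * p ^ 2 * q * r + 173 / 100 * p ^ 2 * r ^ 2 + 173 / 50 * p * q ^ 2 * r + 2 * p
      * q * r ^ 2 + 99 / 100 * q ^ 3 * r + 1 / 4 * q ^ 2 * r ^ 2 + 1 / 2 * p ^ 2 * r ^ 3 + 37 /
      25 * p * q * r ^ 3 + 99 / 100 * p * r ^ 4 + q ^ 2 * r ^ 3 + 99 / 100 * q * r ^ 4 by
      positivity]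
  have : 0 ≤ driftGap p q r draw win lose draw := by
    simp [driftGap, nextWeight, weight, corrector, drawBound, winBound, loseBound]
    linarith [mul_nonneg hp' (show 0 ≤ p * q + p * r ^ 2 + 13 / 4 * q * r ^ 2 + 7 / 2 * r ^ 3 + p
      ^ 2 * r ^ 3 + 5 / 2 * p * q * r ^ 3 by positivity), mul_nonneg hq' (show 0 ≤ 3 / 2 * p * q
      + 1 / 2 * q ^ 2 + 7 / 4 * q * r ^ 2 + 2 * p * q * r ^ 3 + 1 / 2 * q ^ 2 * r ^ 3 by
      positivity), mul_nonneg hr' (show 0 ≤ 3 / 4 * r + 7 / 4 * p ^ 2 + 5 / 2 * p * q + 3 / 4 * q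
      ^ 2 + 4 * q * r ^ 2 + r ^ 3 + p ^ 2 * r ^ 3 + 2 * p * q * r ^ 3 + q ^ 2 * r ^ 3 by
      positivity), show 0 ≤ 197 / 200 * r + 193 / 200 * p ^ 2 + 43 / 20 * p * q + 1 / 2 * p * r +
      29 / 40 * q ^ 2 + 173 / 100 * p * r ^ 2 + 91 / 50 * q * r ^ 2 + 83 / 50 * r ^ 3 + p ^ 3 * r
      + 5 / 2 * p ^ 2 * q * r + 2 * p * q ^ 2 * r + 1 / 2 * q ^ 3 * r + p ^ 2 * q * r ^ 2 + 271 /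
      100 * p ^ 2 * r ^ 3 + 3 / 2 * p * q ^ 2 * r ^ 2 + 537 / 100 * p * q * r ^ 3 + 2 * p * r ^ 4
      + 1 / 2 * q ^ 3 * r ^ 2 + 68 / 25 * q ^ 2 * r ^ 3 + 2 * q * r ^ 4 by positivity]
  rcases a with _ | _ | _ <;> rcases d with _ | _ | _ <;>
    first
    | assumption
    | simp [driftGap, nextWeight, weight, corrector, drawBound]

/-- When neither `a` nor `d` is `lose`, the linear part of the gap is `49/50 q - r/2`. This is where
`r` must be controlled by `q`. -/
theorem driftGap_nonneg_win_draw {p q r : ℝ} (hp : 0 ≤ p) (hq : 0 ≤ q) (hr : 0 ≤ r)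
    (hp' : 0 ≤ 1 / 50 - p) (hq' : 0 ≤ 1 / 50 - q) (hr' : 0 ≤ 1 / 50 - r)
    (h : 0 ≤ 7 / 4 * q + p ^ 2 - r) (a d : Status) :
    0 ≤ driftGap p q r a win draw d := by
  have : 0 ≤ driftGap p q r win win draw win := by
    simp [driftGap, nextWeight, weight, corrector, drawBound, winBound, loseBound]
    linarith [mul_nonneg hp' (show 0 ≤ 11 / 4 * p * r + p ^ 2 * r ^ 2 + 2 * p * q * r ^ 2 by
      positivity), mul_nonneg hq' (show 0 ≤ p * q + 21 / 4 * p * r + 3 * r ^ 2 by positivity),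
      mul_nonneg hr' (show 0 ≤ 4 * p * r + 1 / 2 * p ^ 3 + p * q ^ 2 * r by positivity),
      mul_nonneg h (show 0 ≤ 1 / 2 by positivity), show 0 ≤ 21 / 200 * q + 23 / 100 * p ^ 2 + 323
      / 100 * p * q + 501 / 100 * p * r + 2 * q * r + 147 / 50 * r ^ 2 + 149 / 100 * p ^ 3 + 1 /
      2 * p ^ 2 * q + 3 / 2 * p ^ 2 * q * r + 99 / 50 * p ^ 2 * r ^ 2 + 99 / 50 * p * q ^ 2 * r +
      49 / 25 * p * q * r ^ 2 by positivity]
  have : 0 ≤ driftGap p q r win win draw lose := by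
    simp [driftGap, nextWeight, weight, corrector, drawBound, winBound, loseBound]
    linarith [mul_nonneg hp' (show 0 ≤ r ^ 2 + r ^ 3 + p ^ 2 * r ^ 3 + 2 * p * q * r ^ 3 by
      positivity), mul_nonneg hq' (show 0 ≤ 1 / 4 * q + p * q + 5 / 2 * r ^ 2 + 13 / 4 * p * r ^
      2 + p * q * r ^ 3 by positivity), mul_nonneg hr' (show 0 ≤ 3 / 4 * p * q + 1 / 4 * r ^ 2 +
      1 / 2 * p ^ 3 + 5 / 2 * p ^ 2 * r + 1 / 4 * q ^ 2 * r by positivity), show 0 ≤ 1 / 2 * p +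
      19 / 40 * q + 23 / 100 * p ^ 2 + 393 / 200 * p * q + 7 / 4 * p * r + q * r + 107 / 40 * r ^
      2 + 99 / 100 * p ^ 3 + 1 / 5 * p ^ 2 * r + 37 / 200 * p * r ^ 2 + 99 / 200 * q ^ 2 * r + 23
      / 100 * r ^ 3 + 1 / 2 * p ^ 2 * q * r + p * q ^ 2 * r + 1 / 2 * p ^ 3 * r ^ 2 + 3 / 2 * p ^
      2 * q * r ^ 2 + 99 / 50 * p ^ 2 * r ^ 3 + p * q ^ 2 * r ^ 2 + 97 / 50 * p * q * r ^ 3 by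
      positivity]
  have : 0 ≤ driftGap p q r win win draw draw := by
    simp [driftGap, nextWeight, weight, corrector, drawBound, winBound, loseBound]
    linarith [mul_nonneg hp' (show 0 ≤ 1 / 2 * p * r by positivity), mul_nonneg hq' (show 0 ≤ p *
      q + 5 / 2 * p * r + 3 * r ^ 2 by positivity), mul_nonneg hr' (show 0 ≤ 3 * p * r + p ^ 3 by
      positivity), mul_nonneg h (show 0 ≤ 1 / 2 by positivity), show 0 ≤ 21 / 200 * q + 23 / 100
      * p ^ 2 + 323 / 100 * p * q + 169 / 50 * p * r + 2 * q * r + 147 / 50 * r ^ 2 + 37 / 25 * p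
      ^ 3 + 1 / 2 * p ^ 2 * q + p * q ^ 2 * r by positivity]
  have : 0 ≤ driftGap p q r lose win draw win := by
    simp [driftGap, nextWeight, weight, corrector, drawBound, winBound, loseBound]
    linarith [mul_nonneg hp' (show 0 ≤ 1 / 2 * p * q + 19 / 4 * p * r + 2 * p ^ 2 * r ^ 2 by
      positivity), mul_nonneg hq' (show 0 ≤ 1 / 4 * q + 3 / 2 * p * q + 27 / 4 * p * r + 5 / 2 *
      r ^ 2 by positivity), mul_nonneg hr' (show 0 ≤ 4 * p * r + 1 / 4 * q ^ 2 * r + 4 * p ^ 2 *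
      q * r + 2 * p * q ^ 2 * r by positivity), show 0 ≤ 59 / 40 * q + 37 / 25 * p ^ 2 + 371 /
      100 * p * q + 247 / 50 * p * r + q * r + 27 / 10 * r ^ 2 + p ^ 3 + 99 / 200 * q ^ 2 * r + p
      ^ 3 * r + 221 / 50 * p ^ 2 * q * r + 321 / 100 * p ^ 2 * r ^ 2 + 173 / 50 * p * q ^ 2 * r +
      3 * p * q * r ^ 2 by positivity]
  have : 0 ≤ driftGap p q r lose win draw lose := by
    simp [driftGap, nextWeight, weight, corrector, drawBound, winBound, loseBound]
    linarith [mul_nonneg hp' (show 0 ≤ 2 * p * q + 17 / 4 * p * r + 1 / 4 * q * r ^ 2 + 1 / 2 * r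
      ^ 3 + p ^ 2 * r ^ 3 + 2 * p * q * r ^ 3 by positivity), mul_nonneg hq' (show 0 ≤ 1 / 2 * q
      + 2 * p * q + 9 / 4 * r ^ 2 + p * q * r ^ 3 by positivity), mul_nonneg hr' (show 0 ≤ 19 / 4
      * p * q + 9 / 4 * p * r + 1 / 4 * r ^ 2 + 1 / 2 * q ^ 2 * r + p ^ 3 * r + 3 / 2 * p ^ 2 * q
      * r + 1 / 2 * p * q ^ 2 * r by positivity), show 0 ≤ 97 / 100 * q + 1 / 2 * r + 99 / 50 * p
      ^ 2 + 133 / 40 * p * q + 78 / 25 * p * r + 49 / 20 * r ^ 2 + 99 / 100 * q ^ 2 * r + 49 /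
      200 * q * r ^ 2 + 6 / 25 * r ^ 3 + 99 / 50 * p ^ 3 * r + 547 / 100 * p ^ 2 * q * r + 3 / 4
      * p ^ 2 * r ^ 2 + 349 / 100 * p * q ^ 2 * r + 37 / 25 * p ^ 2 * r ^ 3 + 36 / 25 * p * q * r
      ^ 3 by positivity]
  have : 0 ≤ driftGap p q r lose win draw draw := by
    simp [driftGap, nextWeight, weight, corrector, drawBound, winBound, loseBound]
    linarith [mul_nonneg hp' (show 0 ≤ 1 / 2 * p * q + 7 / 2 * p * r + p ^ 2 * r ^ 2 by
      positivity), mul_nonneg hq' (show 0 ≤ 1 / 4 * q + 3 / 2 * p * q + 5 * p * r + 5 / 2 * r ^ 2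
      by positivity), mul_nonneg hr' (show 0 ≤ 7 / 2 * p * r + 1 / 4 * q ^ 2 * r + 2 * p ^ 2 * q
      * r + p * q ^ 2 * r by positivity), show 0 ≤ 59 / 40 * q + 37 / 25 * p ^ 2 + 371 / 100 * p
      * q + 94 / 25 * p * r + q * r + 27 / 10 * r ^ 2 + p ^ 3 + 99 / 200 * q ^ 2 * r + p ^ 3 * r
      + 99 / 25 * p ^ 2 * q * r + 173 / 100 * p ^ 2 * r ^ 2 + 149 / 50 * p * q ^ 2 * r + 3 / 2 *
      p * q * r ^ 2 by positivity]
  have : 0 ≤ driftGap p q r draw win draw win := by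
    simp [driftGap, nextWeight, weight, corrector, drawBound, winBound, loseBound]
    linarith [mul_nonneg hp' (show 0 ≤ 4 * p * r + 2 * p ^ 2 * r ^ 2 + 4 * p * q * r ^ 2 by
      positivity), mul_nonneg hq' (show 0 ≤ p * q + 7 * p * r + 3 * r ^ 2 by positivity),
      mul_nonneg hr' (show 0 ≤ 4 * p * r + 2 * p * q ^ 2 * r by positivity), mul_nonneg h (show 0
      ≤ 1 / 2 by positivity), show 0 ≤ 21 / 200 * q + 12 / 25 * p ^ 2 + 199 / 50 * p * q + 57 /
      10 * p * r + 2 * q * r + 147 / 50 * r ^ 2 + 2 * p ^ 3 + p ^ 2 * q + 3 * p ^ 2 * q * r + 74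
      / 25 * p ^ 2 * r ^ 2 + 74 / 25 * p * q ^ 2 * r + 73 / 25 * p * q * r ^ 2 by positivity]
  have : 0 ≤ driftGap p q r draw win draw lose := by
    simp [driftGap, nextWeight, weight, corrector, drawBound, winBound, loseBound]
    linarith [mul_nonneg hp' (show 0 ≤ 1 / 2 * p * q + 4 * p * r + p ^ 2 * r ^ 2 + p ^ 2 * r ^ 3
      + 2 * p * q * r ^ 3 by positivity), mul_nonneg hq' (show 0 ≤ 1 / 4 * q + 3 / 2 * p * q + 11
      / 2 * p * r + 5 / 2 * r ^ 2 + p * q * r ^ 3 by positivity), mul_nonneg hr' (show 0 ≤ 13 / 4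
      * p * r + 1 / 4 * q ^ 2 * r + 3 / 2 * p ^ 2 * q * r + 1 / 2 * p * q ^ 2 * r by positivity),
      show 0 ≤ 19 / 40 * q + 37 / 25 * p ^ 2 + 371 / 100 * p * q + 849 / 200 * p * r + q * r + 27
      / 10 * r ^ 2 + p ^ 3 + 99 / 200 * q ^ 2 * r + p ^ 3 * r + 397 / 100 * p ^ 2 * q * r + 37 /
      25 * p ^ 2 * r ^ 2 + 299 / 100 * p * q ^ 2 * r + 3 / 4 * p * q * r ^ 2 + 49 / 50 * p ^ 2 *
      r ^ 3 + 47 / 50 * p * q * r ^ 3 by positivity]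
  have : 0 ≤ driftGap p q r draw win draw draw := by
    simp [driftGap, nextWeight, weight, corrector, drawBound, winBound, loseBound]
    linarith [mul_nonneg hp' (show 0 ≤ 13 / 4 * p * r + p ^ 2 * r ^ 2 + 2 * p * q * r ^ 2 by
      positivity), mul_nonneg hq' (show 0 ≤ p * q + 23 / 4 * p * r + 3 * r ^ 2 by positivity),
      mul_nonneg hr' (show 0 ≤ 9 / 2 * p * r + 1 / 2 * p ^ 2 * r ^ 2 + p * q ^ 2 * r + 1 / 2 * p
      * q * r ^ 2 by positivity), mul_nonneg h (show 0 ≤ 1 / 2 by positivity), show 0 ≤ 21 / 200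
      * q + 12 / 25 * p ^ 2 + 199 / 50 * p * q + 249 / 50 * p * r + 2 * q * r + 147 / 50 * r ^ 2
      + 2 * p ^ 3 + p ^ 2 * q + 5 / 2 * p ^ 2 * q * r + 247 / 100 * p ^ 2 * r ^ 2 + 62 / 25 * p *
      q ^ 2 * r + 49 / 20 * p * q * r ^ 2 + 1 / 2 * p * r ^ 3 by positivity]
  rcases a with _ | _ | _ <;> rcases d with _ | _ | _ <;> assumption

theorem driftGap_nonneg_lose_lose {p q r : ℝ} (hp : 0 ≤ p) (hq : 0 ≤ q) (hr : 0 ≤ r)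
    (hp' : 0 ≤ 1 / 50 - p) (hq' : 0 ≤ 1 / 50 - q) (hr' : 0 ≤ 1 / 50 - r)
    (a d : Status) :
    0 ≤ driftGap p q r a lose lose d := by
  have : 0 ≤ driftGap p q r win lose lose draw := by
    simp [driftGap, nextWeight, weight, corrector, drawBound, winBound, loseBound]
    linarith [mul_nonneg hp' (show 0 ≤ 3 / 4 * r + p * q * r + p * r ^ 2 by positivity),
      mul_nonneg hq' (show 0 ≤ 3 / 2 * p * q * r + 1 / 2 * q ^ 2 * r + 5 / 4 * q * r ^ 2 by
      positivity), mul_nonneg hr' (show 0 ≤ 1 / 4 * r + 11 / 4 * p * q * r + 1 / 2 * p * r ^ 2 +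
      q * r ^ 2 by positivity), show 0 ≤ 49 / 50 * r + p ^ 2 * r + 429 / 200 * p * q * r + 61 /
      50 * p * r ^ 2 + 37 / 50 * q ^ 2 * r + 191 / 200 * q * r ^ 2 + 1 / 2 * r ^ 3 + p ^ 2 * q *
      r ^ 2 + 3 / 2 * p * q ^ 2 * r ^ 2 + 1 / 2 * p * q * r ^ 3 + 1 / 2 * q ^ 3 * r ^ 2 + 1 / 2 *
      q ^ 2 * r ^ 3 by positivity]
  have : 0 ≤ driftGap p q r lose lose lose draw := by
    simp [driftGap, nextWeight, weight, corrector, drawBound, winBound, loseBound]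
    linarith [mul_nonneg hp' (show 0 ≤ 3 / 4 * r + p * q * r + 1 / 2 * q * r ^ 3 + 1 / 2 * r ^ 4
      by positivity), mul_nonneg hq' (show 0 ≤ 3 / 2 * p * q * r + 1 / 2 * q ^ 2 * r + 1 / 2 * q
      * r ^ 3 by positivity), mul_nonneg hr' (show 0 ≤ 1 / 2 * r ^ 2 + p ^ 2 * r + 9 / 4 * p * q
      * r + 3 / 4 * q ^ 2 * r + q * r ^ 3 by positivity), show 0 ≤ 197 / 200 * r + 6 / 25 * r ^ 2
      + 49 / 50 * p ^ 2 * r + 431 / 200 * p * q * r + 3 / 4 * p * r ^ 2 + 29 / 40 * q ^ 2 * r + 1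
      / 2 * p * r ^ 3 + 24 / 25 * q * r ^ 3 + 49 / 100 * r ^ 4 + p ^ 2 * q * r ^ 2 + 3 / 2 * p *
      q ^ 2 * r ^ 2 + 1 / 2 * q ^ 3 * r ^ 2 + 1 / 2 * p * q * r ^ 4 + 1 / 2 * q ^ 2 * r ^ 4 by
      positivity]
  have : 0 ≤ driftGap p q r draw lose lose draw := by
    simp [driftGap, nextWeight, weight, corrector, drawBound, winBound, loseBound]
    linarith [mul_nonneg hp' (show 0 ≤ 3 / 2 * r + 2 * p * q * r + q * r ^ 3 + r ^ 4 by
      positivity), mul_nonneg hq' (show 0 ≤ 3 * p * q * r + q ^ 2 * r + q * r ^ 3 by positivity),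
      mul_nonneg hr' (show 0 ≤ r ^ 2 + 2 * p ^ 2 * r + 9 / 2 * p * q * r + 3 / 2 * q ^ 2 * r + 2
      * q * r ^ 3 by positivity), show 0 ≤ 197 / 100 * r + 12 / 25 * r ^ 2 + 49 / 25 * p ^ 2 * r
      + 431 / 100 * p * q * r + 3 / 2 * p * r ^ 2 + 29 / 20 * q ^ 2 * r + p * r ^ 3 + 48 / 25 * q
      * r ^ 3 + 49 / 50 * r ^ 4 + 2 * p ^ 2 * q * r ^ 2 + 3 * p * q ^ 2 * r ^ 2 + q ^ 3 * r ^ 2 +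
      p * q * r ^ 4 + q ^ 2 * r ^ 4 by positivity]
  rcases a with _ | _ | _ <;> rcases d with _ | _ | _ <;>
    first
    | assumption
    | (rw [driftGap_symm]; assumption)
    | simp [driftGap, nextWeight, weight, corrector, drawBound]

-- The bound on `r` is needed when `a` and `d` are such that `a ≠ draw` and `d ≠ lose`. The linear
-- part of the gap is then `49/50 q - r/2` for `d = win` and `93/100 q - r/2` for `d = draw`, so the
-- coefficient `7/4` has to stay below about `1.86`.
set_option maxHeartbeats 400000 in
theorem driftGap_nonneg_lose_draw {p q r : ℝ} (hp : 0 ≤ p) (hq : 0 ≤ q) (hr : 0 ≤ r)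
    (hp' : 0 ≤ 1 / 50 - p) (hq' : 0 ≤ 1 / 50 - q) (hr' : 0 ≤ 1 / 50 - r)
    (h : 0 ≤ 7 / 4 * q + p ^ 2 - r) (a d : Status) :
    0 ≤ driftGap p q r a lose draw d := by
  have : 0 ≤ driftGap p q r win lose draw win := by
    simp [driftGap, nextWeight, weight, corrector, drawBound, winBound, loseBound]
    linarith [mul_nonneg hp' (show 0 ≤ p * q + 15 / 4 * p * r ^ 2 + 2 * p ^ 2 * r ^ 3 by
      positivity), mul_nonneg hq' (show 0 ≤ 3 / 2 * p * q + 1 / 2 * q ^ 2 + 9 / 4 * q * r + 7 / 2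
      * p * r ^ 2 + 3 / 2 * r ^ 3 + 1 / 2 * q ^ 2 * r ^ 2 + 2 * p * q * r ^ 3 by positivity),
      mul_nonneg hr' (show 0 ≤ 3 / 2 * p ^ 2 + 5 / 4 * p * q + q * r + 7 / 2 * p * r ^ 2 + 3 / 4
      * q ^ 2 * r ^ 2 + 4 * p ^ 2 * q * r ^ 2 by positivity), mul_nonneg h (show 0 ≤ 1 / 2 + r by
      positivity), show 0 ≤ 21 / 200 * q + 9 / 20 * p ^ 2 + 87 / 40 * p * q + 3 / 4 * p * r + 37
      / 50 * q ^ 2 + 137 / 200 * q * r + 1 / 4 * r ^ 2 + 657 / 200 * p * r ^ 2 + 111 / 50 * r ^ 3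
      + p ^ 3 * r + 3 / 2 * p ^ 2 * q * r + 3 / 2 * p * q ^ 2 * r + q ^ 3 * r + 89 / 40 * q ^ 2 *
      r ^ 2 + p ^ 3 * r ^ 2 + 171 / 50 * p ^ 2 * q * r ^ 2 + 321 / 100 * p ^ 2 * r ^ 3 + 2 * p *
      q ^ 2 * r ^ 2 + 123 / 50 * p * q * r ^ 3 by positivity]
  have : 0 ≤ driftGap p q r win lose draw lose := by
    simp [driftGap, nextWeight, weight, corrector, drawBound, winBound, loseBound]
    linarith [mul_nonneg hp' (show 0 ≤ 1 / 20 + 1 / 20 * p + 3 * p * q * r + 25 / 4 * p * r ^ 2 +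
      p ^ 2 * r ^ 4 by positivity), mul_nonneg hq' (show 0 ≤ 1 / 20 + 7 / 2 * p * q * r + 1 / 2 *
      q ^ 2 * r + q * r ^ 2 + 4 * r ^ 3 + 1 / 2 * q ^ 2 * r ^ 3 + 2 * p ^ 2 * r ^ 4 + p * q * r ^
      4 by positivity), mul_nonneg hr' (show 0 ≤ 21 / 20 + 5 / 4 * p + r + 39 / 4 * p * q * r + 4
      * p * r ^ 2 + 1 / 2 * r ^ 3 + p ^ 3 * r ^ 2 + 5 / 2 * p ^ 2 * q * r ^ 2 + 2 * p * q ^ 2 * r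
      ^ 2 + 1 / 2 * q ^ 2 * r ^ 3 by positivity), show 0 ≤ 477 / 1000 + 3 / 125 * p + 3 / 100 * q
      + 3 / 100 * r + 3 / 100 * p ^ 2 + 2 * q * r + 3 * p ^ 2 * r + 217 / 40 * p * q * r + 1009 /
      200 * p * r ^ 2 + 6 / 25 * q ^ 2 * r + 49 / 50 * q * r ^ 2 + 79 / 25 * r ^ 3 + 99 / 50 * p
      ^ 3 * r ^ 2 + 149 / 20 * p ^ 2 * q * r ^ 2 + 7 / 4 * p ^ 2 * r ^ 3 + 323 / 50 * p * q ^ 2 *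
      r ^ 2 + 3 * p * q * r ^ 3 + q ^ 3 * r ^ 2 + 123 / 100 * q ^ 2 * r ^ 3 + q * r ^ 4 + 36 / 25
      * p ^ 2 * r ^ 4 + 49 / 50 * p * q * r ^ 4 by positivity]
  have : 0 ≤ driftGap p q r win lose draw draw := by
    simp [driftGap, nextWeight, weight, corrector, drawBound, winBound, loseBound]
    linarith [mul_nonneg hp' (show 0 ≤ p * q + 7 / 2 * p * r ^ 2 + p ^ 2 * r ^ 3 by positivity),
      mul_nonneg hq' (show 0 ≤ 3 / 2 * p * q + 1 / 2 * q ^ 2 + 3 / 2 * q * r + 9 / 2 * p * r ^ 2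
      + 5 / 2 * r ^ 3 by positivity), mul_nonneg hr' (show 0 ≤ 1 / 2 * p ^ 2 + 7 / 2 * p * r ^ 2
      + 1 / 4 * q ^ 2 * r ^ 2 + 2 * p ^ 2 * q * r ^ 2 + p * q ^ 2 * r ^ 2 by positivity),
      mul_nonneg h (show 0 ≤ 1 / 2 + r by positivity), show 0 ≤ 11 / 200 * q + 47 / 100 * p ^ 2 +
      11 / 5 * p * q + 37 / 50 * q ^ 2 + 18 / 25 * q * r + p * q * r + 327 / 100 * p * r ^ 2 + 27
      / 10 * r ^ 3 + p ^ 3 * r + 1 / 2 * p ^ 2 * q * r + 1 / 2 * q ^ 3 * r + 199 / 200 * q ^ 2 *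
      r ^ 2 + p ^ 3 * r ^ 2 + 99 / 25 * p ^ 2 * q * r ^ 2 + 173 / 100 * p ^ 2 * r ^ 3 + 149 / 50
      * p * q ^ 2 * r ^ 2 + 3 / 2 * p * q * r ^ 3 by positivity]
  have : 0 ≤ driftGap p q r lose lose draw win := by
    simp [driftGap, nextWeight, weight, corrector, drawBound, winBound, loseBound]
    linarith [mul_nonneg hp' (show 0 ≤ p * q + 5 / 2 * p * r ^ 2 + p ^ 2 * r ^ 3 + 2 * p * q * r
      ^ 3 by positivity), mul_nonneg hq' (show 0 ≤ 3 / 2 * p * q + 1 / 2 * q ^ 2 + 4 * p * r ^ 2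
      + 5 * r ^ 3 + p * q * r ^ 3 + 1 / 2 * q * r ^ 4 by positivity), mul_nonneg hr' (show 0 ≤ 33
      / 20 * r + 3 / 2 * p ^ 2 + 3 / 4 * p * q + 7 / 4 * q ^ 2 + 11 / 2 * p * r ^ 2 + 1 / 2 * r ^
      3 + 1 / 2 * q ^ 3 * r + 1 / 2 * p ^ 2 * r ^ 3 + p * q * r ^ 3 by positivity), mul_nonneg h
      (show 0 ≤ 107 / 200 + 6 / 7 * r by positivity), show 0 ≤ 7 / 160 * q + 1 / 500 * r + 83 /
      200 * p ^ 2 + 437 / 200 * p * q + 1 / 4 * p * r + 141 / 200 * q ^ 2 + 1 / 140 * r ^ 2 + 1 /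
      7 * p ^ 2 * r + 119 / 25 * p * r ^ 2 + 5 / 2 * q * r ^ 2 + 389 / 100 * r ^ 3 + p ^ 3 * r +
      3 / 2 * p ^ 2 * q * r + 3 / 2 * p * q ^ 2 * r + 99 / 100 * q ^ 3 * r + 1 / 2 * q ^ 2 * r ^
      2 + 3 / 2 * p ^ 2 * q * r ^ 2 + 247 / 100 * p ^ 2 * r ^ 3 + p * q ^ 2 * r ^ 2 + 171 / 50 *
      p * q * r ^ 3 + p * r ^ 4 + q ^ 2 * r ^ 3 + 99 / 100 * q * r ^ 4 by positivity]
  have : 0 ≤ driftGap p q r lose lose draw lose := by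
    simp [driftGap, nextWeight, weight, corrector, drawBound, winBound, loseBound]
    linarith [mul_nonneg hp' (show 0 ≤ 1 / 20 + 1 / 20 * p + 3 * p * q * r + 9 / 2 * p * r ^ 2 +
      1 / 2 * p * r ^ 3 + 1 / 2 * q * r ^ 3 + 5 / 2 * r ^ 4 + p ^ 2 * r ^ 4 + 2 * p * q * r ^ 4
      by positivity), mul_nonneg hq' (show 0 ≤ 1 / 20 + 7 / 2 * p * q * r + 1 / 2 * q ^ 2 * r + 3
      / 4 * q * r ^ 2 + 7 / 4 * r ^ 3 + 2 * r ^ 4 + p * q * r ^ 4 + 1 / 2 * q * r ^ 5 by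
      positivity), mul_nonneg hr' (show 0 ≤ 31 / 20 + 5 / 4 * p + 3 / 4 * r + 31 / 4 * p * q * r
      + 7 / 4 * p * r ^ 2 + 1 / 2 * r ^ 4 + 1 / 2 * p ^ 2 * q * r ^ 2 + p * q ^ 2 * r ^ 2 + 1 / 2
      * q ^ 3 * r ^ 2 + 1 / 2 * p ^ 2 * r ^ 4 + p * q * r ^ 4 by positivity), show 0 ≤ 467 / 1000
      + 3 / 125 * p + 3 / 100 * q + 7 / 200 * r + 3 / 100 * p ^ 2 + 2 * q * r + 3 * p ^ 2 * r +
      1093 / 200 * p * q * r + 33 / 8 * p * r ^ 2 + 6 / 25 * q ^ 2 * r + 97 / 200 * q * r ^ 2 +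
      393 / 200 * r ^ 3 + 6 / 25 * p * r ^ 3 + 6 / 25 * q * r ^ 3 + 9 / 10 * r ^ 4 + p ^ 3 * r ^
      2 + 549 / 100 * p ^ 2 * q * r ^ 2 + 137 / 25 * p * q ^ 2 * r ^ 2 + 99 / 100 * q ^ 3 * r ^ 2
      + 247 / 100 * p ^ 2 * r ^ 4 + 171 / 50 * p * q * r ^ 4 + p * r ^ 5 + q ^ 2 * r ^ 4 + 99 /
      100 * q * r ^ 5 by positivity]
  have : 0 ≤ driftGap p q r lose lose draw draw := by
    simp [driftGap, nextWeight, weight, corrector, drawBound, winBound, loseBound]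
    linarith [mul_nonneg hp' (show 0 ≤ 1 / 2 * p ^ 2 + p * q + 9 / 4 * p * r ^ 2 by positivity),
      mul_nonneg hq' (show 0 ≤ 3 / 2 * p * q + 1 / 2 * q ^ 2 + 9 / 2 * p * r ^ 2 + 1 / 4 * q * r
      ^ 2 + 4 * r ^ 3 by positivity), mul_nonneg hr' (show 0 ≤ 7 / 5 * r + 1 / 2 * p ^ 2 + q ^ 2
      + 4 * p * r ^ 2 by positivity), mul_nonneg h (show 0 ≤ 53 / 100 + 1 / 2 * p + 6 / 7 * r by
      positivity), show 0 ≤ 1 / 400 * q + 1 / 500 * r + 43 / 100 * p ^ 2 + 53 / 40 * p * q + 18 /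
      25 * q ^ 2 + 1 / 140 * r ^ 2 + 1 / 7 * p ^ 2 * r + 3 / 2 * p * q * r + 857 / 200 * p * r ^
      2 + 499 / 200 * q * r ^ 2 + 171 / 50 * r ^ 3 + p ^ 3 * r + 1 / 2 * p ^ 2 * q * r + 1 / 2 *
      q ^ 3 * r + 2 * p ^ 2 * q * r ^ 2 + 1 / 2 * p ^ 2 * r ^ 3 + 2 * p * q ^ 2 * r ^ 2 + p * q *
      r ^ 3 + 1 / 2 * q ^ 2 * r ^ 3 by positivity]
  have : 0 ≤ driftGap p q r draw lose draw win := by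
    simp [driftGap, nextWeight, weight, corrector, drawBound, winBound, loseBound]
    linarith [mul_nonneg hp' (show 0 ≤ 1 / 2 * r + p * q + 5 * p * r ^ 2 + p ^ 2 * r ^ 3 + 5 / 2
      * p * q * r ^ 3 + p ^ 2 * r ^ 4 by positivity), mul_nonneg hq' (show 0 ≤ 3 / 2 * p * q + 1
      / 2 * q ^ 2 + q * r + 35 / 4 * p * r ^ 2 + 5 / 4 * q * r ^ 2 + 13 / 2 * r ^ 3 + 2 * p * q *
      r ^ 3 + 1 / 2 * q ^ 2 * r ^ 3 + 2 * p ^ 2 * r ^ 4 + p * q * r ^ 4 by positivity),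
      mul_nonneg hr' (show 0 ≤ 9 / 4 * r + 6 * p * r ^ 2 + r ^ 3 + 1 / 4 * p * q * r ^ 3 + q ^ 2
      * r ^ 3 by positivity), show 0 ≤ 49 / 50 * q + 89 / 200 * r + 49 / 50 * p ^ 2 + 11 / 5 * p
      * q + 37 / 50 * q ^ 2 + 37 / 25 * q * r + 1 / 2 * p ^ 2 * r + 3 / 2 * p * q * r + 1171 /
      200 * p * r ^ 2 + 119 / 40 * q * r ^ 2 + 87 / 20 * r ^ 3 + p ^ 3 * r + 1 / 2 * p ^ 2 * q *
      r + 1 / 2 * q ^ 3 * r + p ^ 3 * r ^ 2 + 5 * p ^ 2 * q * r ^ 2 + 62 / 25 * p ^ 2 * r ^ 3 + 9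
      / 2 * p * q ^ 2 * r ^ 2 + 981 / 200 * p * q * r ^ 3 + p * r ^ 4 + 1 / 2 * q ^ 3 * r ^ 2 +
      247 / 100 * q ^ 2 * r ^ 3 + 2 * q * r ^ 4 + 47 / 50 * p ^ 2 * r ^ 4 + 23 / 100 * p * q * r
      ^ 4 by positivity]
  have : 0 ≤ driftGap p q r draw lose draw lose := by
    simp [driftGap, nextWeight, weight, corrector, drawBound, winBound, loseBound]
    linarith [mul_nonneg hp' (show 0 ≤ 1 / 20 + 1 / 20 * p + 4 * p * q * r + 7 * p * r ^ 2 + p *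
      r ^ 3 + q * r ^ 3 + 5 * r ^ 4 + 2 * p ^ 2 * r ^ 4 + 4 * p * q * r ^ 4 by positivity),
      mul_nonneg hq' (show 0 ≤ 1 / 20 + 5 * p * q * r + q ^ 2 * r + 1 / 4 * r ^ 3 + 4 * r ^ 4 + 2
      * p * q * r ^ 4 + q * r ^ 5 by positivity), mul_nonneg hr' (show 0 ≤ 1 / 2 + 2 * p + 12 * p
      * q * r + 1 / 4 * p * r ^ 2 + 2 * q ^ 2 * r + r ^ 4 + p ^ 2 * q * r ^ 2 + 2 * p * q ^ 2 * r
      ^ 2 + q ^ 3 * r ^ 2 + p ^ 2 * r ^ 4 + 2 * p * q * r ^ 4 by positivity), show 0 ≤ 61 / 125 +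
      9 / 1000 * p + 3 / 100 * q + 3 / 100 * p ^ 2 + 2 * q * r + 4 * p ^ 2 * r + 379 / 50 * p * q
      * r + 971 / 200 * p * r ^ 2 + 47 / 50 * q ^ 2 * r + 199 / 200 * r ^ 3 + 23 / 100 * p * r ^
      3 + 23 / 100 * q * r ^ 3 + 9 / 5 * r ^ 4 + 2 * p ^ 3 * r ^ 2 + 449 / 50 * p ^ 2 * q * r ^ 2
      + 224 / 25 * p * q ^ 2 * r ^ 2 + 99 / 50 * q ^ 3 * r ^ 2 + 247 / 50 * p ^ 2 * r ^ 4 + 171 /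
      25 * p * q * r ^ 4 + 2 * p * r ^ 5 + 2 * q ^ 2 * r ^ 4 + 99 / 50 * q * r ^ 5 by positivity]
  have : 0 ≤ driftGap p q r draw lose draw draw := by
    simp [driftGap, nextWeight, weight, corrector, drawBound, winBound, loseBound]
    linarith [mul_nonneg hp' (show 0 ≤ 5 / 4 * r + p * q + 1 / 2 * p * q * r + 19 / 4 * p * r ^ 2
      + 5 / 2 * r ^ 4 + p ^ 2 * r ^ 4 + 2 * p * q * r ^ 4 by positivity), mul_nonneg hq' (show 0
      ≤ 3 / 2 * p * q + 1 / 2 * q ^ 2 + 1 / 4 * q * r + 3 / 2 * p * q * r + 35 / 4 * p * r ^ 2 +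
      3 / 2 * q * r ^ 2 + 5 / 2 * r ^ 3 + 2 * r ^ 4 + p * q * r ^ 4 + 1 / 2 * q * r ^ 5 by
      positivity), mul_nonneg hr' (show 0 ≤ 3 / 2 * r + 5 / 2 * p * r ^ 2 + 1 / 2 * r ^ 4 + 1 / 2
      * p ^ 2 * q * r ^ 2 + p * q ^ 2 * r ^ 2 + 1 / 2 * q ^ 3 * r ^ 2 + 1 / 2 * p ^ 2 * r ^ 4 + p
      * q * r ^ 4 by positivity), show 0 ≤ 93 / 100 * q + 89 / 200 * r + 49 / 50 * p ^ 2 + 11 / 5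
      * p * q + 37 / 50 * q ^ 2 + 299 / 200 * q * r + 3 / 2 * p ^ 2 * r + 371 / 100 * p * q * r +
      493 / 100 * p * r ^ 2 + 197 / 100 * q * r ^ 2 + 49 / 20 * r ^ 3 + p ^ 3 * r + 9 / 10 * r ^
      4 + p ^ 3 * r ^ 2 + 549 / 100 * p ^ 2 * q * r ^ 2 + 137 / 25 * p * q ^ 2 * r ^ 2 + 1 / 2 *
      p * q * r ^ 3 + 99 / 100 * q ^ 3 * r ^ 2 + 1 / 2 * q ^ 2 * r ^ 3 + 247 / 100 * p ^ 2 * r ^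
      4 + 171 / 50 * p * q * r ^ 4 + p * r ^ 5 + q ^ 2 * r ^ 4 + 99 / 100 * q * r ^ 5 by
      positivity]
  rcases a with _ | _ | _ <;> rcases d with _ | _ | _ <;> assumption

theorem driftGap_nonneg_draw_draw {p q r : ℝ} (hp : 0 ≤ p) (hq : 0 ≤ q) (hr : 0 ≤ r)
    (hp' : 0 ≤ 1 / 50 - p) (hq' : 0 ≤ 1 / 50 - q) (hr' : 0 ≤ 1 / 50 - r)
    (a d : Status) :
    0 ≤ driftGap p q r a draw draw d := by
  have : 0 ≤ driftGap p q r win draw draw win := by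
    simp [driftGap, nextWeight, weight, corrector, drawBound, winBound, loseBound]
    linarith [mul_nonneg hp' (show 0 ≤ 3 / 2 * p * r + p * r ^ 2 by positivity), mul_nonneg hq'
      (show 0 ≤ p * q + 5 / 2 * p * r + p * r ^ 2 by positivity), show 0 ≤ 24 / 25 * q + 24 / 25
      * p ^ 2 + 199 / 50 * p * q + 221 / 50 * p * r + 3 * q * r + 2 * p ^ 3 + p ^ 2 * q + 24 / 25
      * p * r ^ 2 + p ^ 2 * q * r + p * q ^ 2 * r by positivity]
  have : 0 ≤ driftGap p q r win draw draw lose := by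
    simp [driftGap, nextWeight, weight, corrector, drawBound, winBound, loseBound]
    linarith [mul_nonneg hp' (show 0 ≤ 1 / 2 * p * q + 7 / 4 * p * r + 1 / 4 * p * r ^ 2 + p * r
      ^ 3 by positivity), mul_nonneg hq' (show 0 ≤ 1 / 4 * q + 3 / 2 * p * q + 3 / 4 * p * r ^ 2
      + p * r ^ 3 by positivity), mul_nonneg hr' (show 0 ≤ 3 / 2 * p * q by positivity), show 0 ≤
      101 / 200 * q + 73 / 50 * p ^ 2 + 92 / 25 * p * q + 693 / 200 * p * r + 5 / 2 * q * r + p ^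
      3 + 23 / 100 * p * r ^ 2 + 1 / 4 * q ^ 2 * r + p ^ 3 * r + 2 * p ^ 2 * q * r + p * q ^ 2 *
      r + 24 / 25 * p * r ^ 3 + 1 / 2 * p ^ 2 * q * r ^ 2 + 1 / 2 * p * q ^ 2 * r ^ 2 by
      positivity]
  have : 0 ≤ driftGap p q r win draw draw draw := by
    simp [driftGap, nextWeight, weight, corrector, drawBound, winBound, loseBound]
    linarith [mul_nonneg hp' (show 0 ≤ 3 / 4 * p * r + 1 / 2 * p * r ^ 3 by positivity),
      mul_nonneg hq' (show 0 ≤ p * q by positivity), mul_nonneg hr' (show 0 ≤ 5 / 4 * p * q + 1 /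
      2 * p * r + 1 / 2 * p * q * r ^ 2 by positivity), show 0 ≤ 24 / 25 * q + 24 / 25 * p ^ 2 +
      791 / 200 * p * q + 149 / 40 * p * r + 3 * q * r + 2 * p ^ 3 + p ^ 2 * q + 1 / 2 * p ^ 2 *
      q * r + 1 / 2 * p ^ 2 * r ^ 2 + 1 / 2 * p * q ^ 2 * r + 49 / 100 * p * q * r ^ 2 + 49 / 100
      * p * r ^ 3 by positivity]
  -- Only `3q/50` is left at first order. The coefficient `19/20` in `corrector` is subtracted twice
  -- here and added once in `lose, lose, draw, draw`, so it cannot be much larger or much smaller.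
  have : 0 ≤ driftGap p q r lose draw draw lose := by
    simp [driftGap, nextWeight, weight, corrector, drawBound, winBound, loseBound]
    linarith [mul_nonneg hp' (show 0 ≤ 2 * p * q + 5 / 2 * p * r ^ 2 + p * r ^ 4 by positivity),
      mul_nonneg hq' (show 0 ≤ 1 / 2 * q + 2 * p * q + 7 / 2 * p * r ^ 2 by positivity),
      mul_nonneg hr' (show 0 ≤ p ^ 2 + p * r ^ 2 + p * q * r ^ 3 by positivity), show 0 ≤ 1 / 20
      * q + 97 / 50 * p ^ 2 + 171 / 50 * p * q + 3 / 2 * p * r + 2 * q * r + 1 / 2 * p * q * r +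
      59 / 25 * p * r ^ 2 + 1 / 2 * q ^ 2 * r + 2 * p ^ 3 * r + 3 * p ^ 2 * q * r + p * q ^ 2 * r
      + p ^ 2 * q * r ^ 2 + p ^ 2 * r ^ 3 + p * q ^ 2 * r ^ 2 + 49 / 50 * p * q * r ^ 3 + 49 / 50
      * p * r ^ 4 by positivity]
  have : 0 ≤ driftGap p q r lose draw draw draw := by
    simp [driftGap, nextWeight, weight, corrector, drawBound, winBound, loseBound]
    linarith [mul_nonneg hp' (show 0 ≤ 1 / 2 * p * q + 1 / 2 * p * r + 3 / 4 * p * r ^ 2 + 1 / 2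
      * p * r ^ 4 by positivity), mul_nonneg hq' (show 0 ≤ 1 / 4 * q + 3 / 2 * p * q + 5 / 4 * p
      * r ^ 2 by positivity), mul_nonneg hr' (show 0 ≤ 1 / 2 * p * r ^ 2 + 1 / 2 * p * q * r ^ 3
      by positivity), show 0 ≤ 101 / 200 * q + 73 / 50 * p ^ 2 + 371 / 100 * p * q + 56 / 25 * p
      * r + 5 / 2 * q * r + p ^ 3 + 1 / 4 * p * q * r + 7 / 10 * p * r ^ 2 + 1 / 4 * q ^ 2 * r +
      p ^ 3 * r + 3 / 2 * p ^ 2 * q * r + 1 / 2 * p * q ^ 2 * r + 1 / 2 * p ^ 2 * q * r ^ 2 + 1 /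
      2 * p ^ 2 * r ^ 3 + 1 / 2 * p * q ^ 2 * r ^ 2 + 49 / 100 * p * q * r ^ 3 + 49 / 100 * p * r
      ^ 4 by positivity]
  -- The terms linear in `p` cancel, so for `q = r = 0` the gap is only of order `p ^ 2`. Hence the
  -- scale `q + p ^ 2` of the drift.
  have : 0 ≤ driftGap p q r draw draw draw draw := by
    simp [driftGap, nextWeight, weight, corrector, drawBound, winBound, loseBound]
    linarith [mul_nonneg hq' (show 0 ≤ p * q by positivity), mul_nonneg hr' (show 0 ≤ p * r by
      positivity), show 0 ≤ 24 / 25 * q + 24 / 25 * p ^ 2 + 199 / 50 * p * q + 149 / 50 * p * r +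
      3 * q * r + 2 * p ^ 3 + p ^ 2 * q + p ^ 2 * r ^ 2 + p * q * r ^ 2 by positivity]
  rcases a with _ | _ | _ <;> rcases d with _ | _ | _ <;>
    first
    | assumption
    | (rw [driftGap_symm]; assumption)

/-! ### The weight of the next antidiagonal -/

theorem transition_nonneg {p q r : ℝ} (hp : 0 ≤ p) (hq : 0 ≤ q) (hpq : p + q ≤ 1) (hr : 0 ≤ r)
    (hr' : r ≤ 1) (s s' t : Status) : 0 ≤ transition p q r s s' t := by
  have hv : ∀ l, 0 ≤ vertexProb p q l := by
    intro l; cases l <;> simp only [vertexProb] <;> linarith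
  have he : ∀ e, 0 ≤ edgeProb r e := by
    intro e; cases e <;> simp only [edgeProb] <;> linarith
  refine Finset.sum_nonneg fun x _ => ?_
  split_ifs
  · exact mul_nonneg (hv _) (mul_nonneg (he _) (he _))
  · exact le_rfl

theorem transition_eq (p q r : ℝ) (s s' t : Status) :
    transition p q r s s' t = (if win = t then p else 0) + (if lose = t then q else 0)
      + (1 - p - q) * ((if combine win win = t then r * r else 0)
        + (if combine win s' = t then r * (1 - r) else 0)
        + (if combine s win = t then (1 - r) * r else 0)
        + (if combine s s' = t then (1 - r) * (1 - r) else 0)) := by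
  simp only [transition, Fintype.sum_prod_type, sum_vertexLabel, sum_edgeLabel, update,
    throughEdge, vertexProb, edgeProb]
  cases s <;> cases s' <;> cases t <;> simp [combine] <;> ring

/-- In this form the winning probability can be eliminated, so that the sites on which a term of
`weight` does not depend sum out to one. -/
theorem transition_win (p q r : ℝ) (s s' : Status) :
    transition p q r s s' win = 1 - transition p q r s s' lose - transition p q r s s' draw := by
  cases s <;> cases s' <;> simp [transition_eq, combine] <;> ring

/-- Here and in the next two bounds, the only losses are multiples of `(1 - p - q) * r ^ 2`, `(p +
q) * r` and `(p + q) * r ^ 2`; the other entries are exact. -/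
theorem transition_draw_le {p q r : ℝ} (hpq : p + q ≤ 1) (s s' : Status) :
    transition p q r s s' draw ≤ drawBound p q r s s' := by
  have h := mul_nonneg (sub_nonneg.2 hpq) (sq_nonneg r)
  cases s <;> cases s' <;> simp [transition_eq, combine, drawBound] <;> nlinarith

theorem transition_win_le {p q r : ℝ} (hpq : p + q ≤ 1) (s s' : Status) :
    transition p q r s s' win ≤ winBound p q r s s' := by
  have h := mul_nonneg (sub_nonneg.2 hpq) (sq_nonneg r)
  cases s <;> cases s' <;> simp [transition_eq, combine, winBound] <;> nlinarith

theorem transition_lose_le {p q r : ℝ} (hp : 0 ≤ p) (hq : 0 ≤ q) (hr : 0 ≤ r) (s s' : Status) :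
    transition p q r s s' lose ≤ loseBound p q r s s' := by
  have h := mul_nonneg (add_nonneg hp hq) (sq_nonneg r)
  have h' := mul_nonneg (add_nonneg hp hq) hr
  cases s <;> cases s' <;> simp [transition_eq, combine, loseBound] <;> nlinarith

theorem sum_weight_mul_transition (p q r : ℝ) (a b c d : Status) :
    ∑ t : Status × Status × Status, weight p r t.1 t.2.1 t.2.2 * (transition p q r a b t.1 *
      transition p q r b c t.2.1 * transition p q r c d t.2.2) =
      nextWeight p r (fun s s' => transition p q r s s' draw)
        (fun s s' => transition p q r s s' win) (fun s s' => transition p q r s s' lose)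
        a b c d := by
  simp only [Fintype.sum_prod_type, sum_status, nextWeight, transition_win]
  simp [weight]
  ring

theorem nextWeight_mono {p r : ℝ} (hp : 0 ≤ p) (hr : 0 ≤ r) {u z o u' z' o' : Status → Status → ℝ}
    (hu : ∀ s s', 0 ≤ u s s') (hz : ∀ s s', 0 ≤ z s s') (ho : ∀ s s', 0 ≤ o s s')
    (hu' : ∀ s s', u s s' ≤ u' s s') (hz' : ∀ s s', z s s' ≤ z' s s')
    (ho' : ∀ s s', o s s' ≤ o' s s') (a b c d : Status) :
    nextWeight p r u z o a b c d ≤ nextWeight p r u' z' o' a b c d := by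
  have hu₀ := fun s s' => (hu s s').trans (hu' s s')
  have hz₀ := fun s s' => (hz s s').trans (hz' s s')
  have ho₀ := fun s s' => (ho s s').trans (ho' s s')
  unfold nextWeight
  gcongr <;> first
    | exact hu _ _
    | exact hz _ _
    | exact ho _ _
    | exact hu₀ _ _
    | exact hz₀ _ _
    | exact ho₀ _ _
    | exact hu' _ _
    | exact hz' _ _
    | exact ho' _ _
    | exact mul_nonneg (ho₀ _ _) (hz₀ _ _)
    | exact mul_nonneg (hu₀ _ _) (hz₀ _ _)

/-- The expectation of a function of a random variable with finitely many values. -/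
theorem sum_measureReal_comp {Ω α β : Type*} [MeasurableSpace Ω] (μ : Measure Ω)
    [IsFiniteMeasure μ] [Fintype α] [Fintype β] [DecidableEq β] [MeasurableSpace α]
    [DiscreteMeasurableSpace α] {Y : Ω → α} (hY : Measurable Y) (g : α → β) (F : β → ℝ) :
    ∑ b, μ.real ((fun ω => g (Y ω)) ⁻¹' {b}) * F b = ∑ a, μ.real (Y ⁻¹' {a}) * F (g a) := by
  rw [← Finset.sum_fiberwise Finset.univ g]
  refine Finset.sum_congr rfl fun b _ => ?_
  have : (fun ω => g (Y ω)) ⁻¹' {b} =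
      Y ⁻¹' ((Finset.univ.filter fun a => g a = b : Finset α) : Set α) := by
    ext ω
    simp
  rw [this, ← sum_measureReal_preimage_singleton _ fun _ _ => hY (.singleton _),
    Finset.sum_mul]
  refine Finset.sum_congr rfl fun a ha => ?_
  rw [(Finset.mem_filter.1 ha).2]

theorem triple_add (v k : Vertex) : triple (v + k) = fun ω => triple v (shift k ω) := by
  ext1 ω
  have : ∀ i, diag (v + k) i = diag v i + k := fun i => by
    ext <;> simp [diag] <;> ring
  simp only [triple, status_shift, this]

theorem measurable_quadruple' (v : Vertex) : Measurable (quadruple v) :=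
  (measurable_quadruple le_rfl).mono (iSup_labelSigma_le _) le_rfl

theorem measurable_triple (v : Vertex) : Measurable (triple v) := by
  have hF : Measurable fun w : Status × Status × Status × Status => (w.1, w.2.1, w.2.2.1) :=
    .of_discrete
  exact hF.comp (measurable_quadruple' v)

theorem boardLaw_real_triple (θ : Theta) (v w : Vertex) (t : Status × Status × Status) :
    (boardLaw θ).real (triple v ⁻¹' {t}) = (boardLaw θ).real (triple w ⁻¹' {t}) := by
  have h : triple v = fun ω => triple w (shift (v - w) ω) := by
    rw [← triple_add, add_sub_cancel]
  rw [h]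
  exact (measurePreserving_shift θ (v - w)).measureReal_preimage
    (measurable_triple w (.singleton t)).nullMeasurableSet

theorem boardLaw_real_triple_eq_sum {p q r : ℝ} (hθ : (p, q, r) ∈ Theta) (v : Vertex)
    (t : Status × Status × Status) :
    (boardLaw ⟨(p, q, r), hθ⟩).real (triple v ⁻¹' {t}) =
      ∑ w : Status × Status × Status × Status,
        (boardLaw ⟨(p, q, r), hθ⟩).real (quadruple (step v .up) ⁻¹' {w}) *
          (transition p q r w.1 w.2.1 t.1 * transition p q r w.2.1 w.2.2.1 t.2.1 *
            transition p q r w.2.2.1 w.2.2.2 t.2.2) := by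
  simp only [← boardLaw_real_quadruple_inter hθ]
  -- Total probability: the measure restricted to the event of the triple is split according to the
  -- quadruple above it.
  have h := sum_measureReal_preimage_singleton
    (μ := (boardLaw ⟨(p, q, r), hθ⟩).restrict (triple v ⁻¹' {t})) Finset.univ
    fun w _ => measurable_quadruple' (step v .up) (.singleton w)
  simp only [measureReal_restrict_apply (measurable_quadruple' (step v .up) (.singleton _))] at h
  rw [h]
  simp

/-! ### Draws have probability zero -/

theorem driftGap_nonneg {p q r : ℝ} (hp : 0 ≤ p) (hq : 0 ≤ q) (hr : 0 ≤ r)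
    (hp' : 0 ≤ 1 / 50 - p) (hq' : 0 ≤ 1 / 50 - q) (hr' : 0 ≤ 1 / 50 - r)
    (h : 0 ≤ 7 / 4 * q + p ^ 2 - r) (a b c d : Status) :
    0 ≤ driftGap p q r a b c d := by
  cases b <;> cases c
  · exact driftGap_nonneg_win_win hp hq hr hp' hq' hr' a d
  · exact driftGap_nonneg_win_lose hp hq hr hp' hq' hr' a d
  · exact driftGap_nonneg_win_draw hp hq hr hp' hq' hr' h a d
  · exact driftGap_symm .. ▸ driftGap_nonneg_win_lose hp hq hr hp' hq' hr' d a
  · exact driftGap_nonneg_lose_lose hp hq hr hp' hq' hr' a d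
  · exact driftGap_nonneg_lose_draw hp hq hr hp' hq' hr' h a d
  · exact driftGap_symm .. ▸ driftGap_nonneg_win_draw hp hq hr hp' hq' hr' h d a
  · exact driftGap_symm .. ▸ driftGap_nonneg_lose_draw hp hq hr hp' hq' hr' h d a
  · exact driftGap_nonneg_draw_draw hp hq hr hp' hq' hr' a d

/-- Stationarity makes the mean drift zero, while `driftGap_nonneg` bounds it below by a positive
multiple of the expected number of draws in the two inner slots. -/
theorem boardLaw_quadruple_eq_zero {p q r : ℝ} (hθ : (p, q, r) ∈ Theta) (hp' : p ≤ 1 / 50)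
    (hq' : q ≤ 1 / 50) (hr' : r ≤ 1 / 50) (h : r ≤ 7 / 4 * q + p ^ 2) (v : Vertex)
    (a c d : Status) :
    (boardLaw ⟨(p, q, r), hθ⟩).real (quadruple (step v .up) ⁻¹' {(a, draw, c, d)}) = 0 := by
  have hp : 0 ≤ p := hθ.1.1
  have hq : 0 ≤ q := hθ.2.1.1
  have hr : 0 ≤ r := hθ.2.2.1.1
  have hr₁ : r ≤ 1 := hθ.2.2.1.2
  have hpos : 0 < p + q + r := hθ.2.2.2.1
  have hpq : p + q ≤ 1 := hθ.2.2.2.2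
  set μ := boardLaw ⟨(p, q, r), hθ⟩ with hμ
  set u := step v .up
  set m : Status × Status × Status × Status → ℝ := fun w => μ.real (quadruple u ⁻¹' {w}) with hm
  set E := ∑ t, μ.real (triple v ⁻¹' {t}) * weight p r t.1 t.2.1 t.2.2 with hE
  have hleft : ∀ F : Status × Status × Status → ℝ,
      ∑ w, m w * F (w.1, w.2.1, w.2.2.1) = ∑ t, μ.real (triple v ⁻¹' {t}) * F t := by
    intro F
    rw [← sum_measureReal_comp μ (measurable_quadruple' u) (fun w => (w.1, w.2.1, w.2.2.1)) F]
    exact Finset.sum_congr rfl fun t _ => by rw [hμ, boardLaw_real_triple _ v u]; rfl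
  have hright : ∀ F : Status × Status × Status → ℝ,
      ∑ w, m w * F (w.2.1, w.2.2.1, w.2.2.2) = ∑ t, μ.real (triple v ⁻¹' {t}) * F t := by
    intro F
    rw [← sum_measureReal_comp μ (measurable_quadruple' u) (fun w => w.2) F]
    have ht : triple (diag u 1) = fun ω => (quadruple u ω).2 := by
      ext1 ω
      simp [triple, quadruple, diag, add_assoc, sub_sub]
    exact Finset.sum_congr rfl fun t _ => by rw [hμ, boardLaw_real_triple _ v (diag u 1), ht]
  have hnext : ∑ w, m w * nextWeight p r (fun s s' => transition p q r s s' draw)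
        (fun s s' => transition p q r s s' win) (fun s s' => transition p q r s s' lose)
        w.1 w.2.1 w.2.2.1 w.2.2.2 = E := by
    simp only [hE, hμ, boardLaw_real_triple_eq_sum hθ, Finset.sum_mul, ← sum_weight_mul_transition,
      Finset.mul_sum]
    rw [Finset.sum_comm]
    refine Finset.sum_congr rfl fun t _ => Finset.sum_congr rfl fun w _ => ?_
    ring
  have hnn := transition_nonneg hp hq hpq hr hr₁
  have hm0 : ∀ w, 0 ≤ m w := fun w => measureReal_nonneg
  -- If `p = q = 0`, then `h` forces `r ≤ 0`, against `0 < p + q + r`.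
  have hc : 0 < (q + p ^ 2) / 50 := by
    by_contra hcon
    have hq0 : q = 0 := by nlinarith [sq_nonneg p]
    have hp0 : p = 0 := by
      rw [hq0] at hcon
      nlinarith [sq_nonneg p]
    rw [hq0, hp0] at h hpos
    norm_num at h
    linarith
  set I : Status × Status × Status × Status → ℝ := fun w =>
    (if w.2.1 = draw then 1 else 0) + (if w.2.2.1 = draw then 1 else 0) with hI
  have hI0 : ∀ w, 0 ≤ I w := fun w => by
    simp only [hI]; split_ifs <;> norm_num
  have hle : ∀ w, m w * ((q + p ^ 2) / 50 * I w) ≤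
      m w * ((weight p r w.1 w.2.1 w.2.2.1 + weight p r w.2.1 w.2.2.1 w.2.2.2) / 2
        - corrector p q r w.1 w.2.1 w.2.2.1 + corrector p q r w.2.1 w.2.2.1 w.2.2.2
        - nextWeight p r (fun s s' => transition p q r s s' draw)
        (fun s s' => transition p q r s s' win) (fun s s' => transition p q r s s' lose)
        w.1 w.2.1 w.2.2.1 w.2.2.2) := by
    intro w
    refine mul_le_mul_of_nonneg_left ?_ (hm0 w)
    have h₁ := driftGap_nonneg hp hq hr (by linarith) (by linarith) (by linarith) (by linarith)
      w.1 w.2.1 w.2.2.1 w.2.2.2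
    have h₂ := nextWeight_mono (p := p) (r := r) hp hr (fun s s' => hnn s s' draw)
      (fun s s' => hnn s s' win) (fun s s' => hnn s s' lose) (transition_draw_le hpq)
      (transition_win_le hpq) (transition_lose_le hp hq hr) w.1 w.2.1 w.2.2.1 w.2.2.2
    unfold driftGap at h₁
    linarith
  have hsum : ∑ w, m w * ((q + p ^ 2) / 50 * I w) ≤ 0 := by
    refine (Finset.sum_le_sum fun w _ => hle w).trans (le_of_eq ?_)
    -- The left and right triples of the quadruple have the same law: the averaged weights have mean
    -- `E`, like the next weight, and the two `corrector` means cancel.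
    have e₁ := hleft fun t => weight p r t.1 t.2.1 t.2.2
    have e₂ := hright fun t => weight p r t.1 t.2.1 t.2.2
    have e₃ := hleft fun t => corrector p q r t.1 t.2.1 t.2.2
    have e₄ := hright fun t => corrector p q r t.1 t.2.1 t.2.2
    simp only [mul_sub, mul_add, mul_div_assoc', add_div, Finset.sum_sub_distrib,
      Finset.sum_add_distrib, ← Finset.sum_div] at *
    rw [e₁, e₂, e₃, e₄, hnext, hE]
    ring
  have hterm : m (a, draw, c, d) * ((q + p ^ 2) / 50 * I (a, draw, c, d)) ≤ 0 :=
    (Finset.single_le_sum (f := fun w => m w * ((q + p ^ 2) / 50 * I w))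
      (fun w _ => mul_nonneg (hm0 w) (mul_nonneg hc.le (hI0 w))) (Finset.mem_univ _)).trans hsum
  have hI1 : 0 < I (a, draw, c, d) := by
    simp only [hI]
    split_ifs <;> norm_num
  exact le_antisymm (nonpos_of_mul_nonpos_left hterm (mul_pos hc hI1)) (hm0 _)

theorem boardLaw_draw_eq_zero {p q r : ℝ} (hθ : (p, q, r) ∈ Theta) (hp' : p ≤ 1 / 50)
    (hq' : q ≤ 1 / 50) (hr' : r ≤ 1 / 50) (h : r ≤ 7 / 4 * q + p ^ 2) (v : Vertex) :
    boardLaw ⟨(p, q, r), hθ⟩ {ω | Draw ω v} = 0 := by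
  -- With this choice `v` is the second vertex of the quadruple; only the inner slots are charged by
  -- the drift.
  set u : Vertex := (v.1 - 1, v.2) with hu
  refine measure_mono_null (t := ⋃ x : Status × Status × Status,
    quadruple (step u .up) ⁻¹' {(x.1, draw, x.2.1, x.2.2)}) ?_ (measure_iUnion_null fun x => ?_)
  · intro ω hω
    have hv : diag (step u .up) 1 = v := by
      ext <;> simp [diag, step, hu]
    refine Set.mem_iUnion.2 ⟨(status ω (diag (step u .up) 0), status ω (diag (step u .up) 2),
      status ω (diag (step u .up) 3)), ?_⟩
    simp [quadruple, hv, status_eq_draw_of_draw hω]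
  · exact (measureReal_eq_zero_iff).1
      (boardLaw_quadruple_eq_zero hθ hp' hq' hr' h u x.1 x.2.1 x.2.2)

/-! ### From the four regimes to the bound on the edge traps -/

/-- To first order `p ≤ q + r` and `4r ≤ p + 4q`, hence `3r ≤ 5q`. The quadratic terms must fit into
the narrow room between `5/3` and `7/4` and into `p ^ 2`. -/
theorem le_of_regimeThree {p q r : ℝ} (hp : 0 ≤ p) (hq : 0 ≤ q) (hr : 0 ≤ r) (hp' : p ≤ 1 / 50)
    (hq' : q ≤ 1 / 50) (hr' : r ≤ 1 / 50) (h : RegimeThree p q r) :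
    r ≤ 7 / 4 * q + p ^ 2 := by
  obtain ⟨-, h₁, -, h₂⟩ := h
  -- The map `t ↦ t * (1 - t)` is increasing on `[0, 1/2]`.
  have hX : p ≤ q + r * (1 - p - q) := by
    by_contra! hc
    have h0 : 0 ≤ q + r * (1 - p - q) := by nlinarith
    have : 0 < (p - (q + r * (1 - p - q))) * (1 - p - (q + r * (1 - p - q))) :=
      mul_pos (by linarith) (by linarith)
    linarith
  by_contra! hc
  -- Under `hc` the first-order bound is `r ≤ 7/12 p`. The weaker `3/4` leaves room for the
  -- quadratic terms and improves `r ≤ 1/50` to `r ≤ 3/200`.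
  have hrp : r ≤ 3 / 4 * p := by
    by_contra! hc'
    nlinarith [mul_nonneg hp hq, mul_nonneg hp hr, mul_nonneg hq hr,
      mul_pos (sub_pos.2 hc) (sub_pos.2 hc'), mul_nonneg (sub_nonneg.2 hr') hr,
      mul_nonneg (sub_nonneg.2 hr') (sub_pos.2 hc').le,
      mul_nonneg (sub_nonneg.2 hr') (sub_pos.2 hc).le, mul_nonneg hr (sub_pos.2 hc').le]
  have hqr := mul_nonneg hq hr
  nlinarith [mul_nonneg hr (sub_nonneg.2 hrp), mul_nonneg hp (sub_nonneg.2 hrp),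
    mul_nonneg hq (sub_nonneg.2 hrp), mul_nonneg hr (sub_nonneg.2 hp'),
    mul_nonneg hr (sub_nonneg.2 hX), mul_nonneg hp (sub_nonneg.2 hX), sq_nonneg (4 * r - 3 * p),
    mul_nonneg hr (sub_pos.2 hc).le]

/-- In all four regimes the edge traps are rare compared to the targets, up to second order. -/
theorem le_of_regime {p q r : ℝ} (hp : 0 ≤ p) (hq : 0 ≤ q) (hr : 0 ≤ r) (hp' : p ≤ 1 / 50)
    (hq' : q ≤ 1 / 50) (hr' : r ≤ 1 / 50) (hu : UniversalCondition p q r)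
    (h : RegimeOne p q r ∨ RegimeTwo p q r ∨ RegimeThree p q r ∨ RegimeFour p q r) :
    r ≤ 7 / 4 * q + p ^ 2 := by
  unfold UniversalCondition at hu
  have hpq := mul_nonneg hp hq
  have hpr := mul_nonneg hp hr
  have hqr := mul_nonneg hq hr
  have hpr' := mul_nonneg (sub_nonneg.2 hp') hr
  have hqr' := mul_nonneg (sub_nonneg.2 hq') hr
  have hrr' := mul_nonneg (sub_nonneg.2 hr') hr
  have hpp' := mul_nonneg (sub_nonneg.2 hp') hp
  have hqq' := mul_nonneg (sub_nonneg.2 hq') hq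
  have hpq' := mul_nonneg (sub_nonneg.2 hp') hq
  -- At first order the universal condition is `2r ≤ p + q`. The first two regimes add `p ≤ q` and
  -- `p ≤ 2q`, and the fourth gives `4r ≤ 6q` by itself.
  rcases h with h | ⟨-, -, h⟩ | h₃ | ⟨-, h⟩
  · unfold RegimeOne at h
    nlinarith
  · nlinarith
  · exact le_of_regimeThree hp hq hr hp' hq' hr' h₃
  · nlinarith

theorem universalCondition_diagonal (ε : ℝ) : UniversalCondition ε ε ε := by
  unfold UniversalCondition
  nlinarith [sq_nonneg ε]

theorem regimeTwo_diagonal {ε : ℝ} (h : 0 < ε) (h' : ε ≤ 1 / 50) : RegimeTwo ε ε ε := by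
  have h₂ : 0 < ε * ε := mul_pos h h
  have h₃ : 0 < ε * ε * ε := mul_pos h₂ h
  have h₄ : 0 ≤ ε * ε * (1 / 50 - ε) := mul_nonneg h₂.le (by linarith)
  have h₅ : 0 ≤ ε * (1 / 50 - ε) := mul_nonneg h.le (by linarith)
  have h₆ : 0 ≤ ε * ε * ε * (1 / 50 - ε) := mul_nonneg h₃.le (by linarith)
  refine ⟨?_, ?_, ?_⟩ <;> nlinarith

theorem mem_Theta_diagonal {ε : ℝ} (h : 0 < ε) (h' : ε ≤ 1 / 50) : (ε, ε, ε) ∈ Theta := by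
  have : ε ∈ Set.Icc (0 : ℝ) 1 := ⟨h.le, by linarith⟩
  refine ⟨this, this, this, ?_, ?_⟩ <;> dsimp only <;> linarith

end PercolationGame

theorem theorem1 :
    (∀ (p q r : ℝ) (hθ : (p, q, r) ∈ PercolationGame.Theta),
      p ≤ 1 / 50 → q ≤ 1 / 50 → r ≤ 1 / 50 →
      PercolationGame.UniversalCondition p q r →
      (PercolationGame.RegimeOne p q r ∨ PercolationGame.RegimeTwo p q r ∨
        PercolationGame.RegimeThree p q r ∨ PercolationGame.RegimeFour p q r) →
      ∀ v : PercolationGame.Vertex,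
        PercolationGame.boardLaw ⟨(p, q, r), hθ⟩ {ω | PercolationGame.Draw ω v} = 0) ∧
    (∀ ε : ℝ, 0 < ε → ε ≤ 1 / 50 →
      PercolationGame.UniversalCondition ε ε ε ∧ PercolationGame.RegimeTwo ε ε ε ∧
      ∃ hθ : (ε, ε, ε) ∈ PercolationGame.Theta, ∀ v : PercolationGame.Vertex,
        PercolationGame.boardLaw ⟨(ε, ε, ε), hθ⟩ {ω | PercolationGame.Draw ω v} = 0) := by
  have main : ∀ (p q r : ℝ) (hθ : (p, q, r) ∈ PercolationGame.Theta),
      p ≤ 1 / 50 → q ≤ 1 / 50 → r ≤ 1 / 50 →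
      PercolationGame.UniversalCondition p q r →
      (PercolationGame.RegimeOne p q r ∨ PercolationGame.RegimeTwo p q r ∨
        PercolationGame.RegimeThree p q r ∨ PercolationGame.RegimeFour p q r) →
      ∀ v : PercolationGame.Vertex,
        PercolationGame.boardLaw ⟨(p, q, r), hθ⟩ {ω | PercolationGame.Draw ω v} = 0 :=
    fun p q r hθ hp hq hr hu h v => PercolationGame.boardLaw_draw_eq_zero hθ hp hq hr
      (PercolationGame.le_of_regime hθ.1.1 hθ.2.1.1 hθ.2.2.1.1 hp hq hr hu h) v
  refine ⟨main, fun ε h h' => ?_⟩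
  have hu := PercolationGame.universalCondition_diagonal ε
  have h₂ := PercolationGame.regimeTwo_diagonal h h'
  exact ⟨hu, h₂, PercolationGame.mem_Theta_diagonal h h',
    main ε ε ε _ h' h' h' hu (Or.inr (Or.inl h₂))⟩
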